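/- **Setting.** A *square grid domain* $\Omega$ is a finite simply connected union of faces of $\mathbb Z^2$ whose boundary is a simple closed curve; $\mathcal E$ is its set of edges and $\partial\mathcal E\subset\mathcal E$ the set of boundary edges (edges are identified with their midpoints). For $e\in\partial\mathcal E$ let $\tau_{\mathrm{cw}}(e)\in\{\pm1,\pm i\}$ be the clockwise tangent to the boundary and $\tau_{\mathrm{ccw}}=-\tau_{\mathrm{cw}}$; $w\parallel\tau^{-1/2}$ means $w\in\mathbb R\,\tau^{-1/2}$. With $\lambda=e^{i\pi/4}$, a function $F:\mathcal E\to\mathbb C$ is *s-holomorphic* if for every face of $\Omega$, with edges $E,N,W,S$, $$F(N)+\lambda\overline{F(N)}=F(E)+\lambda\overline{F(E)},\qquad F(N)+\lambda^{-1}\overline{F(N)}=F(W)+\lambda^{-1}\overline{F(W)},$$ $$F(S)+\lambda^{3}\overline{F(S)}=F(E)+\lambda^{3}\overline{F(E)},\qquad F(S)+\lambda^{-3}\overline{F(S)}=F(W)+\lambda^{-3}\overline{F(W)}.$$ *Critical parafermionic observable.* Let $\beta_c=\tfrac12\ln(\sqrt2+1)$ and $\alpha=e^{-2\beta_c}$.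 The dual graph has the faces of $\Omega$ as vertices and a dual edge for each edge of $\Omega$ shared by two faces of $\Omega$. Put $\mathcal Z=\sum_\omega\alpha^{|\omega|}$, the sum over sets $\omega$ of dual edges with even degree at every face. For $a\in\partial\mathcal E$ and $z\in\mathcal E$, $z\ne a$, put $$f_\Omega(a,z)=\frac1{\mathcal Z}\sum_{\gamma}\alpha^{|\gamma|+1}e^{-\frac i2 \mathbf W(\gamma:a\to z)},$$ where a configuration $\gamma$ consists of a set of $|\gamma|$ dual edges not containing the dual edge through $z$, the half-edge from $a$ to the adjacent face of $\Omega$, and one half-edge from a face of $\Omega$ adjacent to $z$ to $z$, such that every face has an even number of edges and half-edges of $\gamma$; $\mathbf W(\gamma:a\to z)$ is the total turning angle (counterclockwise positive) of a path in $\gamma$ from $a$ to $z$ that uses no edge twice and, at each face where four edges or half-edges of $\gamma$ meet, turns left or right. Put $f_\Omega(a,a)=1$. **Statement.** Let $\Omega$ be a square grid domain and $\mathfrak b\subset\partial\mathcal E$ a set of boundary edges. Let $\mathcal R$ (resp. $\mathcal I$) be the real vector space of functions $g:\mathfrak b\to\mathbb C$ with $g\parallel\tau_{\mathrm{ccw}}^{-1/2}$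 (resp. $g\parallel\tau_{\mathrm{cw}}^{-1/2}$) on $\mathfrak b$. For every $u\in\mathcal R$ there is a unique $v=:U_\Omega^{\mathfrak b}u\in\mathcal I$ such that $u+v$ has an s-holomorphic extension $h:\mathcal E\to\mathbb C$ with $h\parallel\tau_{\mathrm{cw}}^{-1/2}$ on $\partial\mathcal E\setminus\mathfrak b$. This RPS (Riemann Poincaré–Steklov) operator $U_\Omega^{\mathfrak b}:\mathcal R\to\mathcal I$, $u\mapsto v$, is given by $$v(x)=\sum_{y\in\mathfrak b\setminus\{x\}}u(y)\,f_\Omega(y,x)\qquad\text{for all }x\in\mathfrak b,$$ and the right-hand side equals $h(x)$ for $x\in\partial\mathcal E\setminus\mathfrak b$. The s-holomorphic extension $h$ is given by $$h(x)=\sum_{y\in\mathfrak b}u(y)\,f_\Omega(y,x)\qquad\text{for all }x\in\mathcal E.$$ -/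

import Mathlib

noncomputable section

namespace IsingRPS

open scoped Classical

/-! ### The square grid -/

/-- A face of the square lattice `ℤ²`, named by its lower-left corner. -/
abbrev Face : Type := ℤ × ℤ

/-- An edge of `ℤ²`: `horiz x y` joins `(x, y)` to `(x + 1, y)`, and `vert x y` joins `(x, y)` to
`(x, y + 1)`. -/
inductive Edge : Type where
  | horiz (x y : ℤ) : Edge
  | vert (x y : ℤ) : Edge
  deriving DecidableEq

/-- The four lattice directions: `0` is East, `1` is North, `2` is West, `3` is South. -/
abbrev Dir : Type := Fin 4

/-- The unit complex number `i ^ d` pointing in the direction `d`. -/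
def dirVec (d : Dir) : ℂ := Complex.I ^ (d : ℕ)

/-- The neighbour of a face in a given direction. -/
def nbr (p : Face) (d : Dir) : Face :=
  match d with
  | 0 => (p.1 + 1, p.2)
  | 1 => (p.1, p.2 + 1)
  | 2 => (p.1 - 1, p.2)
  | 3 => (p.1, p.2 - 1)

/-- The edge of the face `p` on its side `d`; it separates `p` from `nbr p d`. -/
def edgeOf (p : Face) (d : Dir) : Edge :=
  match d with
  | 0 => Edge.vert (p.1 + 1) p.2
  | 1 => Edge.horiz p.1 (p.2 + 1)
  | 2 => Edge.vert p.1 p.2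
  | 3 => Edge.horiz p.1 p.2

/-- A side of a face. It also stands for the dual half-edge that joins the centre of the face `s.1`
to the midpoint of the edge `edgeOf s.1 s.2`. -/
abbrev Side : Type := Face × Dir

/-- Two faces are adjacent if they share an edge. -/
def faceGraph : SimpleGraph Face := SimpleGraph.fromRel fun p q => ∃ d, q = nbr p d

/-- A square grid domain: a finite simply connected union of faces of `ℤ²` whose boundary is a
simple closed curve. For a finite set of faces this means that both the set and its complement are
connected through edges: connectedness of the complement excludes holes, and pinch points where
two faces of the domain meet only at a corner. -/
structure SquareGridDomain where
  faces : Finset Face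
  connected : (faceGraph.induce {p | p ∈ faces}).Connected
  compl_connected : (faceGraph.induce {p | p ∉ faces}).Connected

namespace SquareGridDomain

variable (Ω : SquareGridDomain)

/-- The edges of the domain. -/
def edges : Finset Edge :=
  (Ω.faces ×ˢ (Finset.univ : Finset Dir)).image fun s => edgeOf s.1 s.2

/-- The sides of faces of the domain that lie along `e`. -/
def sidesAt (e : Edge) : Finset Side :=
  (Ω.faces ×ˢ (Finset.univ : Finset Dir)).filter fun s => edgeOf s.1 s.2 = e

/-- The boundary edges: those adjacent to exactly one face of the domain. -/
def boundary : Finset Edge := Ω.edges.filter fun e => (Ω.sidesAt e).card = 1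

/-- The edges adjacent to two faces of the domain. Each of them is crossed by exactly one edge of
the dual graph (whose vertices are the faces of the domain), and dual edges are identified with the
edges that they cross. -/
def interior : Finset Edge := Ω.edges.filter fun e => (Ω.sidesAt e).card = 2

/-- The face of the domain adjacent to a boundary edge `e`, with the direction of `e` seen from
there, which is that of the outward normal (junk if `e` is not an edge of the domain). -/
def innerSide (e : Edge) : Side :=
  if h : (Ω.sidesAt e).Nonempty then h.choose else ((0, 0), 0)

/-- The clockwise unit tangent of the boundary at a boundary edge: the outward normal
turned by `-π/2`. -/
def tauCw (e : Edge) : ℂ := -Complex.I * dirVec (Ω.innerSide e).2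

/-- The counterclockwise unit tangent of the boundary at a boundary edge. -/
def tauCcw (e : Edge) : ℂ := -Ω.tauCw e

end SquareGridDomain

/-- The real line `ℝ τ ^ (-1/2)` in the complex plane (it does not depend on the choice of the
square root). -/
def lineOf (τ : ℂ) : Submodule ℝ ℂ := Submodule.span ℝ {τ ^ (-(1 / 2) : ℂ)}

/-! ### S-holomorphicity -/

/-- `λ = e ^ (i π / 4)`. -/
def lam : ℂ := Complex.exp (Complex.I * Real.pi / 4)

open ComplexConjugate in
/-- S-holomorphicity of a function on the edges of the domain (values at other edges play
no role). -/
def SHolomorphic (Ω : SquareGridDomain) (F : Edge → ℂ) : Prop :=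
  ∀ p ∈ Ω.faces,
    F (edgeOf p 1) + lam * conj (F (edgeOf p 1)) =
        F (edgeOf p 0) + lam * conj (F (edgeOf p 0)) ∧
    F (edgeOf p 1) + lam⁻¹ * conj (F (edgeOf p 1)) =
        F (edgeOf p 2) + lam⁻¹ * conj (F (edgeOf p 2)) ∧
    F (edgeOf p 3) + lam ^ 3 * conj (F (edgeOf p 3)) =
        F (edgeOf p 0) + lam ^ 3 * conj (F (edgeOf p 0)) ∧
    F (edgeOf p 3) + (lam ^ 3)⁻¹ * conj (F (edgeOf p 3)) =
        F (edgeOf p 2) + (lam ^ 3)⁻¹ * conj (F (edgeOf p 2))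

/-! ### The Ising parafermionic observable -/

/-- The set of dual edges `γ`, together with the dual half-edges in the list `S`, contains the half
of a dual edge that issues from the centre of the face `p` in the direction `d`. -/
def Occupied (γ : Finset Edge) (S : List Side) (p : Face) (d : Dir) : Prop :=
  edgeOf p d ∈ γ ∨ (p, d) ∈ S

/-- The number of edges of `γ` and half-edges of `S` at the face `p`. -/
def valence (γ : Finset Edge) (S : List Side) (p : Face) : ℕ :=
  (Finset.univ.filter fun d : Dir => Occupied γ S p d).card

/-- The collections `γ` of dual edges such that every face of the domain has an even number of
edges of `γ` and half-edges of `S`. -/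
def evenCollections (Ω : SquareGridDomain) (S : List Side) : Finset (Finset Edge) :=
  Ω.interior.powerset.filter fun γ => ∀ p ∈ Ω.faces, Even (valence γ S p)

/-- The low temperature expansion `∑ α ^ |ω|` of the partition function, over collections of
loops `ω`, with `α = e ^ (-2β)`. -/
def partitionFunction (β : ℝ) (Ω : SquareGridDomain) : ℝ :=
  ∑ ω ∈ evenCollections Ω [], Real.exp (-2 * β) ^ ω.card

/-- The turning angle from direction `d` to direction `d'` (no walk below makes a U-turn). -/
def turn (d d' : Dir) : ℝ :=
  if d' = d + 1 then Real.pi / 2 else if d' = d - 1 then -(Real.pi / 2) else 0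

/-- The total turning angle of a walk that arrives in direction `d` and then takes the steps
in the given list. -/
def winding : Dir → List Dir → ℝ
  | _, [] => 0
  | d, d' :: ds => turn d d' + winding d' ds

/-- The edges crossed or reached, one after the other, by a walk starting at the centre of `p`. -/
def crossed : Face → List Dir → List Edge
  | _, [] => []
  | p, d :: ds => edgeOf p d :: crossed (nbr p d) ds

/-- `WalkIn γ s t p d ds`: the walk that has arrived at the centre of the face `p` in the direction
`d` and takes the steps `ds` follows edges of `γ`, ends with the half-edge `t`, and at each face
where `γ` with the half-edges `s` and `t` has valence four it turns left or right, that is,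
it never goes straight there. -/
inductive WalkIn (γ : Finset Edge) (s t : Side) : Face → Dir → List Dir → Prop
  | last (p : Face) (d e : Dir) (ht : (p, e) = t) (hturn : valence γ [s, t] p = 4 → e ≠ d) :
      WalkIn γ s t p d [e]
  | step (p : Face) (d e : Dir) (ds : List Dir) (hmem : edgeOf p e ∈ γ)
      (hturn : valence γ [s, t] p = 4 → e ≠ d) (htail : WalkIn γ s t (nbr p e) e ds) :
      WalkIn γ s t p d (e :: ds)

/-- `w` is the total turning angle of an admissible path in `γ` between the edge midpoints at which
the half-edges `s` and `t` end: it starts along `s` (so in the direction opposite to `s.2`),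
ends along `t`, uses no edge twice, and never goes straight at a face of valence four. -/
def IsPathWinding (γ : Finset Edge) (s t : Side) (w : ℝ) : Prop :=
  ∃ ds : List Dir, WalkIn γ s t s.1 (s.2 + 2) ds ∧ (crossed s.1 ds).Nodup ∧
    w = winding (s.2 + 2) ds

/-- The winding `W(γ : a → z)` of an admissible path (of any such path: different choices
agree modulo `4π`). -/
def pathWinding (γ : Finset Edge) (s t : Side) : ℝ :=
  if h : ∃ w, IsPathWinding γ s t w then h.choose else 0

/-- The two-point Ising parafermionic observable `f_Ω(a, z)` at inverse temperature `β`, for a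
boundary edge `a` and any edge `z` of the domain. A configuration consists of the half-edge from `a`
to its adjacent face, a half-edge `t` from a face of the domain to `z`, and a collection `γ` of dual
edges other than the one through `z`, with even valence at all faces; its weight is
`α ^ (|γ| + 1) * e ^ (-(i/2) W(γ : a → z))` with `α = e ^ (-2β)`. By convention `f_Ω(a, a) = 1`. -/
def observable (β : ℝ) (Ω : SquareGridDomain) (a z : Edge) : ℂ :=
  if z = a then 1 else
    (partitionFunction β Ω : ℂ)⁻¹ *
      ∑ t ∈ Ω.sidesAt z,
        ∑ γ ∈ (evenCollections Ω [Ω.innerSide a, t]).filter (fun γ => z ∉ γ),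
          ((Real.exp (-2 * β) ^ (γ.card + 1) : ℝ) : ℂ) *
            Complex.exp (-(Complex.I / 2) * (pathWinding γ (Ω.innerSide a) t : ℂ))

/-- The critical inverse temperature of the Ising model on the square lattice. -/
def betaC : ℝ := 1 / 2 * Real.log (√2 + 1)

/-! ### Cauchy data and the RPS operator -/

/-- The functions `u : 𝔟 → ℂ` with `u ∥ τ_ccw ^ (-1/2)` on `𝔟`. -/
def dataR (Ω : SquareGridDomain) (b : Finset Edge) : Submodule ℝ (b → ℂ) :=
  Submodule.pi Set.univ fun e : b => lineOf (Ω.tauCcw e)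

/-- The functions `v : 𝔟 → ℂ` with `v ∥ τ_cw ^ (-1/2)` on `𝔟`. -/
def dataI (Ω : SquareGridDomain) (b : Finset Edge) : Submodule ℝ (b → ℂ) :=
  Submodule.pi Set.univ fun e : b => lineOf (Ω.tauCw e)

/-- `h` is an s-holomorphic extension of `u + v` to the edges of the domain, with
`h ∥ τ_cw ^ (-1/2)` on the boundary edges outside `𝔟`. -/
def IsExtension (Ω : SquareGridDomain) (b : Finset Edge) (u v : b → ℂ) (h : Edge → ℂ) : Prop :=
  SHolomorphic Ω h ∧ (∀ e : b, h e = u e + v e) ∧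
    ∀ e ∈ Ω.boundary, e ∉ b → h e ∈ lineOf (Ω.tauCw e)

/-- The discrete Riemann Poincaré-Steklov operator: it maps `u` to the `v` such that `u + v` has an
s-holomorphic extension with `h ∥ τ_cw ^ (-1/2)` on the boundary edges outside `𝔟`. -/
def rpsOperator (Ω : SquareGridDomain) (b : Finset Edge) (u : dataR Ω b) : dataI Ω b :=
  if hv : ∃ v : dataI Ω b, ∃ h : Edge → ℂ, IsExtension Ω b u v h then hv.choose else 0

end IsingRPS

end

/-! Existence. The nonlocal winding is replaced by a local phase. A configuration with its start
edge adjoined is the set of domain walls of a two-valued height on the vertices (`ray`), branched at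
the face of the tip and at the outer face `o` across the start edge. Outside the domain `o` is
joined to a face lying below all of it, so the branch cut at `o` is absorbed in a fixed reference
`ρ` (`exists_reference`). The direction of the tip and the height at one end of the edge it reaches
give a phase `tipPhase` that changes by `e ^ (-i turn / 2)` at every step of an admissible path
(`edgePhase_step`). Erasing the whole path leaves closed loops, whose height vanishes outside the
domain (`ray_eq_zero_of_outside`). Hence `e ^ (-i W / 2)` is the phase of the tip divided by a
constant `c` of the start edge (`pathWinding_phase`), whichever path is used.

Fix a face `p`. A configuration with tip at an edge of `p` either ends inside `p`, or ends on the
other side, and then adding the edge moves the tip into `p`. So the observable at all four sides of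
`p` is a sum over one common set of configurations (`observable_eq_faceSum`), with relative weight
`1 / α = √2 + 1` when the side is occupied. S-holomorphicity then holds term by term, by a check of
the patterns of odd valence at `p` (`sHolAt_edgePhase`). At a boundary edge other than the start the
tip always points along the outward normal, which puts the values on the line `τ_cw ^ (-1/2)`.
Superposition over the start edges gives the extension (`exists_isExtension`).

Uniqueness. The difference of two extensions is parallel to `τ_cw ^ (-1/2)` on the whole boundary.
The flux of `Im h²` out of a face is never positive (`SHolAt.flux_nonpos`); it cancels across
interior edges and is nonnegative through the boundary. So it vanishes there, hence `h` vanishes on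
the boundary, and the face relations propagate the zero inwards (`SHolomorphic.eq_zero`). -/

noncomputable section
namespace IsingRPS
open scoped Classical

/-! ### Parities and the height function -/

/-- The indicator of a proposition, modulo two. -/
def ind (P : Prop) : ZMod 2 := if P then 1 else 0

theorem ind_true {P : Prop} (h : P) : ind P = 1 := if_pos h

theorem ind_false {P : Prop} (h : ¬P) : ind P = 0 := if_neg h

theorem zmod_two_cases (x : ZMod 2) : x = 0 ∨ x = 1 := by
  revert x; decide

theorem zmod_two_add_self (x : ZMod 2) : x + x = 0 := CharTwo.add_self_eq_zero x

/-! ### Incidence of faces and edges -/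

theorem edgeOf_eq_iff (p q : Face) (d e : Dir) :
    edgeOf p d = edgeOf q e ↔ (q = p ∧ e = d) ∨ (q = nbr p d ∧ e = d + 2) := by
  obtain ⟨x, y⟩ := p
  obtain ⟨x', y'⟩ := q
  fin_cases d <;> fin_cases e <;> simp [edgeOf, nbr, Prod.ext_iff] <;> omega

theorem edgeOf_nbr (p : Face) (d : Dir) : edgeOf (nbr p d) (d + 2) = edgeOf p d :=
  ((edgeOf_eq_iff p (nbr p d) d (d + 2)).2 (Or.inr ⟨rfl, rfl⟩)).symm

theorem nbr_nbr (p : Face) (d : Dir) : nbr (nbr p d) (d + 2) = p := by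
  obtain ⟨x, y⟩ := p
  fin_cases d <;> simp [nbr]

theorem nbr_ne (p : Face) (d : Dir) : nbr p d ≠ p := by
  obtain ⟨x, y⟩ := p
  fin_cases d <;> simp [nbr]

theorem dir_add_two_add_two (d : Dir) : d + 2 + 2 = d := by
  fin_cases d <;> rfl

/-- Whether the edge `e` crosses the upward ray from the vertex `(x, y)`. -/
def onRay (x y : ℤ) : Edge → ZMod 2
  | .vert x' y' => ind (x' = x ∧ y ≤ y')
  | .horiz _ _ => 0

/-- The parity of the number of edges of `G` on the upward ray from the vertex `(x, y)`. -/
def ray (G : Finset Edge) (x y : ℤ) : ZMod 2 := ∑ e ∈ G, onRay x y e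

/-- Whether the horizontal edge `horiz x y` lies below the face `p`. -/
def below (p : Face) (x y : ℤ) : ZMod 2 := ind (p.1 = x ∧ y ≤ p.2)

/-- Every face has an even number of edges of `G`, except that the number is shifted by one
at `q` and at `o`. -/
def Valid (G : Finset Edge) (q o : Face) : Prop :=
  ∀ f : Face, ∑ d, ind (edgeOf f d ∈ G) = ind (f = q) + ind (f = o)

theorem sum_ind_eq (G : Finset Edge) (e : Edge) : ∑ e' ∈ G, ind (e' = e) = ind (e ∈ G) := by
  unfold ind
  convert Finset.sum_ite_eq' G e (fun _ => (1 : ZMod 2))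

theorem ray_vert (G : Finset Edge) (x y : ℤ) :
    ray G x y = ray G x (y + 1) + ind (Edge.vert x y ∈ G) := by
  unfold ray
  rw [← sum_ind_eq, ← Finset.sum_add_distrib]
  refine Finset.sum_congr rfl fun e _ => ?_
  cases e with
  | horiz a b => simp [onRay, ind]
  | vert a b =>
    simp only [onRay, ind, Edge.vert.injEq]
    split_ifs <;> first | rfl | omega

theorem ray_erase {G : Finset Edge} {e : Edge} (h : e ∈ G) (x y : ℤ) :
    ray (G.erase e) x y = ray G x y + onRay x y e := by
  unfold ray
  rw [← Finset.add_sum_erase G _ h, add_comm (onRay x y e), add_assoc, zmod_two_add_self, add_zero]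

theorem exists_height_bound (G : Finset Edge) :
    ∃ N : ℤ, ∀ x y, N ≤ y → Edge.vert x y ∉ G ∧ Edge.horiz x y ∉ G := by
  let ht : Edge → ℤ := fun e => match e with
    | .horiz _ y => y
    | .vert _ y => y
  obtain ⟨M, hM⟩ := (G.image ht).exists_le
  refine ⟨M + 1, fun x y hy => ⟨fun h => ?_, fun h => ?_⟩⟩
  · have := hM _ (Finset.mem_image_of_mem ht h)
    simp only [ht] at this
    omega
  · have := hM _ (Finset.mem_image_of_mem ht h)
    simp only [ht] at this
    omega

theorem ray_eq_zero_of_le {G : Finset Edge} {N : ℤ}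
    (hN : ∀ x y, N ≤ y → Edge.vert x y ∉ G ∧ Edge.horiz x y ∉ G) (x y : ℤ) (hy : N ≤ y) :
    ray G x y = 0 := by
  refine Finset.sum_eq_zero fun e he => ?_
  cases e with
  | horiz a b => rfl
  | vert a b =>
    refine ind_false ?_
    rintro ⟨_, h⟩
    exact (hN a b (hy.trans h)).1 he

theorem below_succ (p : Face) (x y : ℤ) : below p x y = below p x (y + 1) + ind ((x, y) = p) := by
  obtain ⟨a, b⟩ := p
  simp only [below, ind, Prod.mk.injEq]
  split_ifs <;> first | rfl | omega

/-- `G` acts as the domain walls of the spin `ray G`; each of the defects `q` and `o` adds a cut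
running straight down from it. High above `G` every term vanishes, and on the way down the parity
condition at each face carries the identity from its top side to its bottom side. -/
theorem Valid.ray_horiz {G : Finset Edge} {q o : Face} (hG : Valid G q o) (x y : ℤ) :
    ray G x y + ray G (x + 1) y = ind (Edge.horiz x y ∈ G) + below q x y + below o x y := by
  obtain ⟨N, hN⟩ := exists_height_bound G
  set M : ℤ := max N (max (q.2 + 1) (o.2 + 1)) with hM
  have high : ∀ y, M ≤ y →
      ray G x y + ray G (x + 1) y = ind (Edge.horiz x y ∈ G) + below q x y + below o x y := by
    intro y hy
    rw [ray_eq_zero_of_le hN _ _ (by omega), ray_eq_zero_of_le hN _ _ (by omega),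
      ind_false (hN x y (by omega)).2, below, below, ind_false (by omega), ind_false (by omega)]
    rfl
  rcases le_total M y with h | h
  · exact high y h
  · induction y, h using Int.leInductionDown with
    | base => exact high M le_rfl
    | pred k hk ih =>
      have hf := hG (x, k - 1)
      rw [Fin.sum_univ_four] at hf
      simp only [edgeOf, sub_add_cancel] at hf
      have h1 := ray_vert G x (k - 1)
      have h2 := ray_vert G (x + 1) (k - 1)
      have h3 := below_succ q x (k - 1)
      have h4 := below_succ o x (k - 1)
      rw [sub_add_cancel] at h1 h2 h3 h4
      rw [h1, h2, h3, h4]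
      generalize ray G x k = a at *
      generalize ray G (x + 1) k = b at *
      generalize ind (Edge.horiz x k ∈ G) = c at *
      generalize ind (Edge.horiz x (k - 1) ∈ G) = d at *
      generalize ind (Edge.vert x (k - 1) ∈ G) = e at *
      generalize ind (Edge.vert (x + 1) (k - 1) ∈ G) = f at *
      generalize below q x k = g at *
      generalize below o x k = i at *
      generalize ind ((x, k - 1) = q) = j at *
      generalize ind ((x, k - 1) = o) = l at *
      have t : (2 : ZMod 2) = 0 := rfl
      linear_combination ih + hf + (-d) * t

/-! ### Phases -/

/-- The sign `(-1) ^ x`. -/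
def sgn (x : ZMod 2) : ℂ := if x = 0 then 1 else -1

theorem sgn_add (x y : ZMod 2) : sgn (x + y) = sgn x * sgn y := by
  have t : (1 : ZMod 2) + 1 = 0 := rfl
  rcases zmod_two_cases x with rfl | rfl <;> rcases zmod_two_cases y with rfl | rfl <;>
    simp [sgn, t]

theorem sgn_zero : sgn 0 = 1 := if_pos rfl

theorem sgn_one : sgn 1 = -1 := if_neg one_ne_zero

theorem sgn_mul_self (x : ZMod 2) : sgn x * sgn x = 1 := by
  rw [← sgn_add, zmod_two_add_self, sgn_zero]

/-- A square root of the inverse of `dirVec d`. -/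
def eta : Dir → ℂ := ![1, lam⁻¹, -Complex.I, lam]

/-- The end on the left of the edge that is crossed when leaving the face `t.1` in
direction `t.2`. -/
def leftVertex (t : Side) : ℤ × ℤ :=
  match t.2 with
  | 0 => (t.1.1 + 1, t.1.2 + 1)
  | 1 => (t.1.1, t.1.2 + 1)
  | 2 => (t.1.1, t.1.2)
  | 3 => (t.1.1 + 1, t.1.2)

/-- The height of the configuration `G` at a vertex, relative to the reference function `ρ`. -/
def height (ρ : ℤ → ℤ → ZMod 2) (G : Finset Edge) (v : ℤ × ℤ) : ZMod 2 := ray G v.1 v.2 + ρ v.1 v.2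

/-- The phase of a configuration `G` whose tip is the half-edge `t`. -/
def tipPhase (ρ : ℤ → ℤ → ZMod 2) (G : Finset Edge) (t : Side) : ℂ :=
  eta t.2 * sgn (height ρ G (leftVertex t))

/-- The phase at the side `d` of `p` of a configuration with an odd number of edges at `p`. -/
def edgePhase (ρ : ℤ → ℤ → ZMod 2) (G : Finset Edge) (p : Face) (d : Dir) : ℂ :=
  if edgeOf p d ∈ G then tipPhase ρ (G.erase (edgeOf p d)) (nbr p d, d + 2) else tipPhase ρ G (p, d)

/-- The function `ρ` is a reference height along the face `p`: it jumps only across the edges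
below `o`. -/
def IsReference (ρ : ℤ → ℤ → ZMod 2) (o p : Face) : Prop :=
  ρ p.1 p.2 = ρ p.1 (p.2 + 1) ∧ ρ (p.1 + 1) p.2 = ρ (p.1 + 1) (p.2 + 1) ∧
    ρ p.1 p.2 + ρ (p.1 + 1) p.2 = below o p.1 p.2 ∧
    ρ p.1 (p.2 + 1) + ρ (p.1 + 1) (p.2 + 1) = below o p.1 (p.2 + 1)

/-! ### Heights at the corners of the tip face -/

section Corners

variable {ρ : ℤ → ℤ → ZMod 2} {G : Finset Edge} {p o : Face}

theorem height_nw (hρ : IsReference ρ o p) :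
    height ρ G (p.1, p.2 + 1) = height ρ G (p.1, p.2) + ind (edgeOf p 2 ∈ G) := by
  have h := ray_vert G p.1 p.2
  simp only [height, edgeOf, h, hρ.1]
  have t : (2 : ZMod 2) = 0 := rfl
  linear_combination (-ind (Edge.vert p.1 p.2 ∈ G)) * t

theorem height_ne (hρ : IsReference ρ o p) :
    height ρ G (p.1 + 1, p.2 + 1) = height ρ G (p.1 + 1, p.2) + ind (edgeOf p 0 ∈ G) := by
  have h := ray_vert G (p.1 + 1) p.2
  simp only [height, edgeOf, h, hρ.2.1]
  have t : (2 : ZMod 2) = 0 := rfl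
  linear_combination (-ind (Edge.vert (p.1 + 1) p.2 ∈ G)) * t

/-- The extra `1` is the cut of the tip, which leaves the face `p` through its south side; the cut
of `o` has been cancelled by `ρ`. -/
theorem height_se (hρ : IsReference ρ o p) (hG : Valid G p o) :
    height ρ G (p.1 + 1, p.2) = height ρ G (p.1, p.2) + ind (edgeOf p 3 ∈ G) + 1 := by
  have h := hG.ray_horiz p.1 p.2
  have h1 := hρ.2.2.1
  have h2 : below p p.1 p.2 = 1 := ind_true ⟨rfl, le_rfl⟩
  rw [h2] at h
  simp only [height, edgeOf]
  have t : (2 : ZMod 2) = 0 := rfl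
  linear_combination h + h1 + (below o p.1 p.2 - ray G p.1 p.2 - ρ p.1 p.2) * t

end Corners

theorem leftVertex_east (p : Face) : leftVertex (p, 0) = (p.1 + 1, p.2 + 1) := rfl
theorem leftVertex_north (p : Face) : leftVertex (p, 1) = (p.1, p.2 + 1) := rfl
theorem leftVertex_south (p : Face) : leftVertex (p, 3) = (p.1 + 1, p.2) := rfl

theorem height_erase {ρ : ℤ → ℤ → ZMod 2} {G : Finset Edge} {e : Edge} (h : e ∈ G) (v : ℤ × ℤ) :
    height ρ (G.erase e) v = height ρ G v + onRay v.1 v.2 e := by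
  simp only [height, ray_erase h]
  ring

section EdgePhase

variable {ρ : ℤ → ℤ → ZMod 2} {G : Finset Edge} {p o : Face}

/-- In this and the next three lemmas the phase at a side is reduced to the height of the south-west
corner and the occupation of the sides. All relations between phases at one face thus become finite
checks with one common sign. -/
theorem edgePhase_east (hρ : IsReference ρ o p) (hG : Valid G p o) :
    edgePhase ρ G p 0 =
      if edgeOf p 0 ∈ G then -Complex.I * sgn (height ρ G (p.1, p.2) + ind (edgeOf p 3 ∈ G))
      else -sgn (height ρ G (p.1, p.2) + ind (edgeOf p 3 ∈ G)) := by
  unfold edgePhase tipPhase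
  split_ifs with h
  · have e1 : leftVertex (nbr p 0, 0 + 2) = (p.1 + 1, p.2) := rfl
    -- The erased edge starts at this vertex and lies on its ray, which compensates the cut below
    -- the tip.
    have e2 : onRay (p.1 + 1) p.2 (edgeOf p 0) = 1 := ind_true ⟨rfl, le_rfl⟩
    rw [e1, height_erase h, e2, height_se hρ hG, add_assoc, zmod_two_add_self, add_zero]
    rfl
  · rw [leftVertex_east, height_ne hρ, ind_false h, height_se hρ hG, add_zero, sgn_add, sgn_one]
    simp [eta]

theorem edgePhase_north (hρ : IsReference ρ o p) (hG : Valid G p o) :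
    edgePhase ρ G p 1 =
      if edgeOf p 1 ∈ G then
        -lam * sgn (height ρ G (p.1, p.2) + ind (edgeOf p 3 ∈ G) + ind (edgeOf p 0 ∈ G))
      else lam⁻¹ * sgn (height ρ G (p.1, p.2) + ind (edgeOf p 2 ∈ G)) := by
  unfold edgePhase tipPhase
  split_ifs with h
  · have e1 : leftVertex (nbr p 1, 1 + 2) = (p.1 + 1, p.2 + 1) := rfl
    have e2 : onRay (p.1 + 1) (p.2 + 1) (edgeOf p 1) = 0 := rfl
    rw [e1, height_erase h, e2, add_zero, height_ne hρ, height_se hρ hG, add_right_comm, sgn_add _ 1,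
      sgn_one]
    have e3 : eta 3 = lam := rfl
    simp [e3]
  · rw [leftVertex_north, height_nw hρ]
    rfl

theorem edgePhase_west (hρ : IsReference ρ o p) :
    edgePhase ρ G p 2 =
      if edgeOf p 2 ∈ G then -sgn (height ρ G (p.1, p.2))
      else -Complex.I * sgn (height ρ G (p.1, p.2)) := by
  unfold edgePhase tipPhase
  split_ifs with h
  · have e1 : leftVertex (nbr p 2, 2 + 2) = (p.1, p.2 + 1) := by
      change (p.1 - 1 + 1, p.2 + 1) = _
      rw [sub_add_cancel]
    have e2 : onRay p.1 (p.2 + 1) (edgeOf p 2) = 0 := ind_false (by omega)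
    rw [e1, height_erase h, e2, add_zero, height_nw hρ, ind_true h, sgn_add, sgn_one]
    have e3 : eta 0 = 1 := rfl
    simp [e3]
  · rfl

theorem edgePhase_south (hρ : IsReference ρ o p) (hG : Valid G p o) :
    edgePhase ρ G p 3 =
      if edgeOf p 3 ∈ G then lam⁻¹ * sgn (height ρ G (p.1, p.2))
      else -lam * sgn (height ρ G (p.1, p.2)) := by
  unfold edgePhase tipPhase
  split_ifs with h
  · have e1 : leftVertex (nbr p 3, 3 + 2) = (p.1, p.2) := by
      change (p.1, p.2 - 1 + 1) = _
      rw [sub_add_cancel]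
    have e2 : onRay p.1 p.2 (edgeOf p 3) = 0 := rfl
    rw [e1, height_erase h, e2, add_zero]
    rfl
  · rw [leftVertex_south, height_se hρ hG, ind_false h, add_zero, sgn_add, sgn_one]
    have e3 : eta 3 = lam := rfl
    simp [e3]

end EdgePhase

/-! ### S-holomorphicity at one face -/

theorem lam_eq : lam = ((√2 / 2 : ℝ) : ℂ) * (1 + Complex.I) := by
  have h : Complex.I * Real.pi / 4 = ((Real.pi / 4 : ℝ) : ℂ) * Complex.I := by push_cast; ring
  rw [lam, h, Complex.exp_mul_I, ← Complex.ofReal_cos, ← Complex.ofReal_sin, Real.cos_pi_div_four,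
    Real.sin_pi_div_four]
  ring

theorem sqrt_two_sq_complex : ((√2 : ℝ) : ℂ) ^ 2 = 2 := by
  rw [← Complex.ofReal_pow, Real.sq_sqrt zero_le_two]
  norm_num

theorem lam_sq : lam ^ 2 = Complex.I := by
  rw [lam_eq]
  push_cast
  linear_combination ((1 + Complex.I) ^ 2 / 4) * sqrt_two_sq_complex + (1 / 2) * Complex.I_sq

theorem lam_inv : lam⁻¹ = ((√2 / 2 : ℝ) : ℂ) * (1 - Complex.I) := by
  refine inv_eq_of_mul_eq_one_right ?_
  rw [lam_eq]
  push_cast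
  linear_combination (1 - Complex.I ^ 2) / 4 * sqrt_two_sq_complex - (1 / 2) * Complex.I_sq

theorem lam_cube : lam ^ 3 = ((√2 / 2 : ℝ) : ℂ) * (-1 + Complex.I) := by
  rw [pow_succ, lam_sq, lam_eq]
  linear_combination ((√2 / 2 : ℝ) : ℂ) * Complex.I_sq

theorem lam_cube_inv : (lam ^ 3)⁻¹ = ((√2 / 2 : ℝ) : ℂ) * (-1 - Complex.I) := by
  rw [← inv_pow, pow_succ, lam_inv]
  push_cast
  have := Complex.I_sq
  have := sqrt_two_sq_complex
  grind

theorem lam_ne_zero : lam ≠ 0 := Complex.exp_ne_zero _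

theorem lam_mul_inv : lam * lam⁻¹ = 1 := mul_inv_cancel₀ lam_ne_zero

open ComplexConjugate in
theorem conj_lam : conj lam = lam⁻¹ := by
  rw [lam_inv, lam_eq, map_mul, Complex.conj_ofReal, map_add, map_one, Complex.conj_I,
    sub_eq_add_neg]

open ComplexConjugate in
/-- The s-holomorphicity relations between the values at the four sides of a face. -/
def SHolAt (X : Dir → ℂ) : Prop :=
  X 1 + lam * conj (X 1) = X 0 + lam * conj (X 0) ∧
    X 1 + lam⁻¹ * conj (X 1) = X 2 + lam⁻¹ * conj (X 2) ∧
    X 3 + lam ^ 3 * conj (X 3) = X 0 + lam ^ 3 * conj (X 0) ∧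
    X 3 + (lam ^ 3)⁻¹ * conj (X 3) = X 2 + (lam ^ 3)⁻¹ * conj (X 2)

theorem SHolAt.add {X Y : Dir → ℂ} (hX : SHolAt X) (hY : SHolAt Y) : SHolAt (X + Y) := by
  obtain ⟨h1, h2, h3, h4⟩ := hX
  obtain ⟨k1, k2, k3, k4⟩ := hY
  refine ⟨?_, ?_, ?_, ?_⟩ <;> simp only [Pi.add_apply, map_add]
  · linear_combination h1 + k1
  · linear_combination h2 + k2
  · linear_combination h3 + k3
  · linear_combination h4 + k4

theorem SHolAt.smul {X : Dir → ℂ} (hX : SHolAt X) (r : ℝ) : SHolAt (fun d => (r : ℂ) * X d) := by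
  obtain ⟨h1, h2, h3, h4⟩ := hX
  refine ⟨?_, ?_, ?_, ?_⟩ <;> simp only [map_mul, Complex.conj_ofReal]
  · linear_combination (r : ℂ) * h1
  · linear_combination (r : ℂ) * h2
  · linear_combination (r : ℂ) * h3
  · linear_combination (r : ℂ) * h4

theorem SHolAt.zero : SHolAt 0 := by
  simp [SHolAt]

theorem SHolAt.sum {ι : Type*} (s : Finset ι) (X : ι → Dir → ℂ) (h : ∀ i ∈ s, SHolAt (X i)) :
    SHolAt (∑ i ∈ s, X i) :=
  Finset.sum_induction X SHolAt (fun _ _ => SHolAt.add) SHolAt.zero h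

/-- The weight of the side `e` relative to that of the whole configuration. -/
def sideWeight (G : Finset Edge) (e : Edge) : ℝ := if e ∈ G then √2 + 1 else 1

theorem sgn_real (x : ZMod 2) : (starRingEnd ℂ) (sgn x) = sgn x := by
  unfold sgn; split_ifs <;> simp

theorem sgn_add_one (x : ZMod 2) : sgn (x + 1) = -sgn x := by
  rw [sgn_add, sgn_one, mul_neg_one]

/-- Since `p ≠ o`, the number of occupied sides is odd, which leaves eight of the sixteen patterns.
The phases share one sign, so each pattern is an identity in `√2` and `i`; the critical value enters
through `√2 + 1` in `sideWeight`. -/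
theorem sHolAt_edgePhase {ρ : ℤ → ℤ → ZMod 2} {G : Finset Edge} {p o : Face}
    (hρ : IsReference ρ o p) (hG : Valid G p o) (hpo : p ≠ o) :
    SHolAt fun d => (sideWeight G (edgeOf p d) : ℂ) * (lam * edgePhase ρ G p d) := by
  have hsum := hG p
  rw [Fin.sum_univ_four, ind_true rfl, ind_false hpo] at hsum
  have hI := Complex.I_sq
  have h2 := sqrt_two_sq_complex
  simp only [SHolAt, edgePhase_east hρ hG, edgePhase_north hρ hG, edgePhase_west hρ,
    edgePhase_south hρ hG, sideWeight]
  rw [lam_cube_inv, lam_cube]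
  by_cases h0 : edgeOf p 0 ∈ G <;> by_cases h1 : edgeOf p 1 ∈ G <;>
    by_cases h2 : edgeOf p 2 ∈ G <;> by_cases h3 : edgeOf p 3 ∈ G <;>
    simp only [h0, h1, h2, h3, ind_true, ind_false, not_false_eq_true, if_true, if_false] at hsum ⊢ <;>
    first
    | exact absurd hsum (by decide)
    | (clear hsum
       simp only [add_zero, sgn_add_one, map_mul, map_neg, sgn_real, conj_lam, Complex.conj_ofReal,
         Complex.conj_I, map_inv₀, inv_inv]
       simp only [lam_eq]
       clear hG hρ hpo
       generalize sgn (height ρ G (p.1, p.2)) = s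
       push_cast
       generalize ((√2 : ℝ) : ℂ) = r at *
       refine ⟨?_, ?_, ?_, ?_⟩ <;> grind)

/-! ### One step of a path -/

theorem exp_quarter_left : Complex.exp (-(Complex.I / 2) * ((Real.pi / 2 : ℝ) : ℂ)) = lam⁻¹ := by
  rw [lam, ← Complex.exp_neg]
  congr 1
  push_cast
  ring

theorem exp_quarter_right :
    Complex.exp (-(Complex.I / 2) * ((-(Real.pi / 2) : ℝ) : ℂ)) = lam := by
  rw [lam]
  congr 1
  push_cast
  ring

/-- Both phases belong to the same `G` at the same face, so their ratio is determined by the pattern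
of sides. Going straight between two other edges of `G` would give the wrong sign; this is what the
turning rule forbids. -/
theorem edgePhase_step {ρ : ℤ → ℤ → ZMod 2} {G : Finset Edge} {p o : Face}
    (hρ : IsReference ρ o p) (hG : Valid G p o) (hpo : p ≠ o) {d e : Dir}
    (hd : edgeOf p (d + 2) ∈ G) (he : edgeOf p e ∉ G)
    (hturn : e = d → edgeOf p (d + 1) ∉ G ∧ edgeOf p (d + 3) ∉ G) :
    edgePhase ρ G p e =
      edgePhase ρ G p (d + 2) * Complex.exp (-(Complex.I / 2) * (turn d e : ℂ)) := by
  have hsum := hG p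
  rw [Fin.sum_univ_four, ind_true rfl, ind_false hpo] at hsum
  have t01 : turn 0 1 = Real.pi / 2 := by simp [turn]
  have t12 : turn 1 2 = Real.pi / 2 := by simp [turn]
  have t23 : turn 2 3 = Real.pi / 2 := by simp [turn]
  have t30 : turn 3 0 = Real.pi / 2 := by simp [turn]
  have t10 : turn 1 0 = -(Real.pi / 2) := by simp [turn]
  have t21 : turn 2 1 = -(Real.pi / 2) := by simp [turn]
  have t32 : turn 3 2 = -(Real.pi / 2) := by simp [turn]
  have t03 : turn 0 3 = -(Real.pi / 2) := by rw [turn, if_neg (by decide), if_pos (by decide)]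
  have tt (d : Dir) : turn d d = 0 := by fin_cases d <;> simp [turn]
  have hI := Complex.I_sq
  have hq := lam_sq
  have hi := lam_mul_inv
  revert hd he hturn
  fin_cases d <;> fin_cases e <;> simp only [Fin.zero_eta, Fin.mk_one, Fin.reduceFinMk,
    Fin.reduceAdd, t01, t12, t23, t30, t10, t21, t32, t03, tt, exp_quarter_left,
    exp_quarter_right, zero_add,
    edgePhase_east hρ hG, edgePhase_north hρ hG, edgePhase_west hρ, edgePhase_south hρ hG] <;>
    intro hd he hturn <;> first
    | exact absurd hd he
    | by_cases h0 : edgeOf p 0 ∈ G <;> by_cases h1 : edgeOf p 1 ∈ G <;>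
        by_cases h2 : edgeOf p 2 ∈ G <;> by_cases h3 : edgeOf p 3 ∈ G <;>
        simp only [h0, h1, h2, h3, ind_true, ind_false, not_false_eq_true, not_true_eq_false,
          false_and, and_false, if_true, if_false, Fin.reduceEq, forall_true_left] at hsum hd he hturn ⊢ <;>
        first
        | exact absurd hsum (by decide)
        | (try simp only [add_zero, sgn_add_one, Complex.ofReal_zero, mul_zero, Complex.exp_zero]
           generalize sgn (height ρ G (p.1, p.2)) = s
           clear hG hρ hpo hsum
           grind)

/-! ### The geometry of a domain -/

namespace SquareGridDomain

variable (Ω : SquareGridDomain)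

theorem mem_sidesAt {e : Edge} {s : Side} :
    s ∈ Ω.sidesAt e ↔ s.1 ∈ Ω.faces ∧ edgeOf s.1 s.2 = e := by
  simp [sidesAt]

theorem mem_edges {e : Edge} : e ∈ Ω.edges ↔ ∃ p ∈ Ω.faces, ∃ d, edgeOf p d = e := by
  simp [edges]

theorem sidesAt_edgeOf_of_mem {p : Face} {d : Dir} (hp : p ∈ Ω.faces) (hn : nbr p d ∈ Ω.faces) :
    Ω.sidesAt (edgeOf p d) = {(p, d), (nbr p d, d + 2)} := by
  ext ⟨q, e⟩
  rw [mem_sidesAt, Finset.mem_insert, Finset.mem_singleton, Prod.mk.injEq q, Prod.mk.injEq q,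
    eq_comm, edgeOf_eq_iff]
  constructor
  · exact fun h => h.2
  · rintro (⟨rfl, rfl⟩ | ⟨rfl, rfl⟩)
    · exact ⟨hp, Or.inl ⟨rfl, rfl⟩⟩
    · exact ⟨hn, Or.inr ⟨rfl, rfl⟩⟩

theorem sidesAt_edgeOf_of_notMem {p : Face} {d : Dir} (hp : p ∈ Ω.faces) (hn : nbr p d ∉ Ω.faces) :
    Ω.sidesAt (edgeOf p d) = {(p, d)} := by
  ext ⟨q, e⟩
  rw [mem_sidesAt, Finset.mem_singleton, Prod.mk.injEq q, eq_comm, edgeOf_eq_iff]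
  constructor
  · rintro ⟨hq, h | ⟨rfl, _⟩⟩
    · exact h
    · exact absurd hq hn
  · rintro ⟨rfl, rfl⟩
    exact ⟨hp, Or.inl ⟨rfl, rfl⟩⟩

theorem card_sidesAt_of_mem {p : Face} {d : Dir} (hp : p ∈ Ω.faces) (hn : nbr p d ∈ Ω.faces) :
    (Ω.sidesAt (edgeOf p d)).card = 2 := by
  rw [sidesAt_edgeOf_of_mem Ω hp hn, Finset.card_pair]
  exact fun h => nbr_ne p d (Prod.mk.inj h).1.symm

theorem card_sidesAt_of_notMem {p : Face} {d : Dir} (hp : p ∈ Ω.faces) (hn : nbr p d ∉ Ω.faces) :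
    (Ω.sidesAt (edgeOf p d)).card = 1 := by
  rw [sidesAt_edgeOf_of_notMem Ω hp hn, Finset.card_singleton]

theorem edgeOf_mem_boundary {p : Face} {d : Dir} (hp : p ∈ Ω.faces) :
    edgeOf p d ∈ Ω.boundary ↔ nbr p d ∉ Ω.faces := by
  have he : edgeOf p d ∈ Ω.edges := Ω.mem_edges.2 ⟨p, hp, d, rfl⟩
  rw [boundary, Finset.mem_filter]
  by_cases h : nbr p d ∈ Ω.faces
  · simp [h, card_sidesAt_of_mem Ω hp h]
  · simp [h, card_sidesAt_of_notMem Ω hp h, he]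

theorem edgeOf_mem_interior {p : Face} {d : Dir} :
    edgeOf p d ∈ Ω.interior ↔ p ∈ Ω.faces ∧ nbr p d ∈ Ω.faces := by
  rw [interior, Finset.mem_filter]
  by_cases hp : p ∈ Ω.faces
  · have he : edgeOf p d ∈ Ω.edges := Ω.mem_edges.2 ⟨p, hp, d, rfl⟩
    by_cases h : nbr p d ∈ Ω.faces
    · simp [hp, h, card_sidesAt_of_mem Ω hp h, he]
    · simp [h, card_sidesAt_of_notMem Ω hp h]
  · simp only [hp, false_and, iff_false, not_and]
    intro _ hc
    by_cases h : nbr p d ∈ Ω.faces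
    · have := card_sidesAt_of_notMem Ω (d := d + 2) h (by rwa [nbr_nbr])
      rw [edgeOf_nbr] at this
      omega
    · obtain ⟨⟨q, e⟩, hq⟩ := Finset.card_pos.1 (by omega : 0 < (Ω.sidesAt (edgeOf p d)).card)
      rw [mem_sidesAt] at hq
      rcases (edgeOf_eq_iff p q d e).1 hq.2.symm with ⟨rfl, _⟩ | ⟨rfl, _⟩
      · exact hp hq.1
      · exact h hq.1

theorem innerSide_mem {e : Edge} (he : e ∈ Ω.boundary) : Ω.innerSide e ∈ Ω.sidesAt e := by
  have h : (Ω.sidesAt e).Nonempty :=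
    Finset.card_pos.1 (by rw [(Finset.mem_filter.1 he).2]; exact one_pos)
  rw [innerSide, dif_pos h]
  exact h.choose_spec

theorem edgeOf_innerSide {e : Edge} (he : e ∈ Ω.boundary) :
    edgeOf (Ω.innerSide e).1 (Ω.innerSide e).2 = e :=
  (Ω.mem_sidesAt.1 (Ω.innerSide_mem he)).2

theorem innerSide_fst_mem {e : Edge} (he : e ∈ Ω.boundary) : (Ω.innerSide e).1 ∈ Ω.faces :=
  (Ω.mem_sidesAt.1 (Ω.innerSide_mem he)).1

theorem nbr_innerSide_notMem {e : Edge} (he : e ∈ Ω.boundary) :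
    nbr (Ω.innerSide e).1 (Ω.innerSide e).2 ∉ Ω.faces := by
  rw [← Ω.edgeOf_mem_boundary (Ω.innerSide_fst_mem he), Ω.edgeOf_innerSide he]
  exact he

theorem innerSide_edgeOf {p : Face} {d : Dir} (hp : p ∈ Ω.faces) (hn : nbr p d ∉ Ω.faces) :
    Ω.innerSide (edgeOf p d) = (p, d) := by
  have := Ω.innerSide_mem ((Ω.edgeOf_mem_boundary hp).2 hn)
  rwa [sidesAt_edgeOf_of_notMem Ω hp hn, Finset.mem_singleton] at this

/-- Induction over the faces outside the domain. -/
theorem compl_induction {P : Face → Prop} {f : Face} (hf : f ∉ Ω.faces) (hP : P f)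
    (step : ∀ f d, f ∉ Ω.faces → nbr f d ∉ Ω.faces → P f → P (nbr f d)) {o : Face}
    (ho : o ∉ Ω.faces) : P o := by
  obtain ⟨w⟩ := Ω.compl_connected.preconnected ⟨f, hf⟩ ⟨o, ho⟩
  have key : ∀ (u v : {p | p ∉ Ω.faces})
      (_ : (faceGraph.induce {p | p ∉ Ω.faces}).Walk u v), P u → P v := by
    intro u v w
    induction w with
    | nil => exact id
    | @cons u v w h _ ih =>
      intro hu
      refine ih ?_
      have hadj : faceGraph.Adj (u : Face) (v : Face) := h
      rw [faceGraph, SimpleGraph.fromRel_adj] at hadj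
      obtain ⟨_, ⟨d, hd⟩ | ⟨d, hd⟩⟩ := hadj
      · have hv := v.2
        rw [hd] at hv ⊢
        exact step _ d u.2 hv hu
      · have : (v : Face) = nbr u (d + 2) := by rw [hd, nbr_nbr]
        have hv := v.2
        rw [this] at hv ⊢
        exact step _ _ u.2 hv hu
  exact key _ _ w hP

/-- For `o` below the whole domain no edge of the domain lies below `o`, and `ρ = 0` works. The face
`o` is then moved through the complement: a horizontal step adds to `ρ` the indicator of the
vertical half-line separating the two columns, while a vertical step changes `below o` at no face of
the domain. -/
theorem exists_reference {o : Face} (ho : o ∉ Ω.faces) :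
    ∃ ρ, ∀ p ∈ Ω.faces, IsReference ρ o p := by
  obtain ⟨M, hM⟩ := (Ω.faces.image fun p => -p.2).exists_le
  have hM' : ∀ p ∈ Ω.faces, -M ≤ p.2 := fun p hp => by
    have := hM _ (Finset.mem_image_of_mem _ hp)
    omega
  have hf : ((0, -M - 1) : Face) ∉ Ω.faces := fun h => by
    have := hM' _ h
    simp only at this
    omega
  refine Ω.compl_induction (P := fun o => ∃ ρ, ∀ p ∈ Ω.faces, IsReference ρ o p) hf ?_ ?_ ho
  · refine ⟨0, fun p hp => ⟨rfl, rfl, ?_, ?_⟩⟩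
    · have := hM' p hp
      simp only [Pi.zero_apply, below, add_zero]
      exact (ind_false (by omega)).symm
    · have := hM' p hp
      simp only [Pi.zero_apply, below, add_zero]
      exact (ind_false (by omega)).symm
  · rintro ⟨a, b⟩ d ho hn ⟨ρ, hρ⟩
    have hne : ∀ p ∈ Ω.faces, ¬(p.1 = a ∧ p.2 = b) := by
      rintro ⟨x, y⟩ hp ⟨rfl, rfl⟩
      exact ho hp
    have hne' : ∀ p ∈ Ω.faces, ¬(p.1 = (nbr (a, b) d).1 ∧ p.2 = (nbr (a, b) d).2) := by
      rintro ⟨x, y⟩ hp ⟨h1, h2⟩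
      simp only at h1 h2
      rw [h1, h2] at hp
      exact hn hp
    fin_cases d
    · refine ⟨fun x y => ρ x y + ind (x = a + 1 ∧ y ≤ b), fun p hp => ?_⟩
      obtain ⟨h1, h2, h3, h4⟩ := hρ p hp
      have k := hne p hp
      have k' := hne' p hp
      simp only [nbr] at k'
      simp only [below, nbr] at h3 h4 ⊢
      refine ⟨?_, ?_, ?_, ?_⟩
      · beta_reduce; rw [h1]; simp only [ind]; split_ifs <;> first | rfl | omega
      · beta_reduce; rw [h2]; simp only [ind]; split_ifs <;> first | rfl | omega
      · beta_reduce; rw [add_add_add_comm, h3]; simp only [below, ind]; split_ifs <;> first | rfl | omega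
      · beta_reduce; rw [add_add_add_comm, h4]; simp only [below, ind]; split_ifs <;> first | rfl | omega
    · refine ⟨ρ, fun p hp => ?_⟩
      obtain ⟨h1, h2, h3, h4⟩ := hρ p hp
      have k := hne p hp
      have k' := hne' p hp
      simp only [nbr] at k'
      simp only [below, nbr] at h3 h4 ⊢
      refine ⟨h1, h2, ?_, ?_⟩
      · rw [h3]; simp only [below, ind]; split_ifs <;> first | rfl | omega
      · rw [h4]; simp only [below, ind]; split_ifs <;> first | rfl | omega
    · refine ⟨fun x y => ρ x y + ind (x = a ∧ y ≤ b), fun p hp => ?_⟩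
      obtain ⟨h1, h2, h3, h4⟩ := hρ p hp
      have k := hne p hp
      have k' := hne' p hp
      simp only [nbr] at k'
      simp only [below, nbr] at h3 h4 ⊢
      refine ⟨?_, ?_, ?_, ?_⟩
      · beta_reduce; rw [h1]; simp only [ind]; split_ifs <;> first | rfl | omega
      · beta_reduce; rw [h2]; simp only [ind]; split_ifs <;> first | rfl | omega
      · beta_reduce; rw [add_add_add_comm, h3]; simp only [below, ind]; split_ifs <;> first | rfl | omega
      · beta_reduce; rw [add_add_add_comm, h4]; simp only [below, ind]; split_ifs <;> first | rfl | omega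
    · refine ⟨ρ, fun p hp => ?_⟩
      obtain ⟨h1, h2, h3, h4⟩ := hρ p hp
      have k := hne p hp
      have k' := hne' p hp
      simp only [nbr] at k'
      simp only [below, nbr] at h3 h4 ⊢
      refine ⟨h1, h2, ?_, ?_⟩
      · rw [h3]; simp only [below, ind]; split_ifs <;> first | rfl | omega
      · rw [h4]; simp only [below, ind]; split_ifs <;> first | rfl | omega

end SquareGridDomain

/-- With both defects at the same face the cuts cancel, so the height jumps only across edges of
`G`. -/
theorem Valid.ray_corner {G : Finset Edge} {o f : Face} (hG : Valid G o o)
    (hf : ∀ d, edgeOf f d ∉ G) :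
    ray G (f.1 + 1) f.2 = ray G f.1 f.2 ∧ ray G f.1 (f.2 + 1) = ray G f.1 f.2 ∧
      ray G (f.1 + 1) (f.2 + 1) = ray G f.1 f.2 := by
  have h0 := ray_vert G (f.1 + 1) f.2
  have h2 := ray_vert G f.1 f.2
  have h3 := hG.ray_horiz f.1 f.2
  rw [show ind (Edge.vert (f.1 + 1) f.2 ∈ G) = 0 from ind_false (hf 0), add_zero] at h0
  rw [show ind (Edge.vert f.1 f.2 ∈ G) = 0 from ind_false (hf 2), add_zero] at h2
  rw [show ind (Edge.horiz f.1 f.2 ∈ G) = 0 from ind_false (hf 3), zero_add, zmod_two_add_self, CharTwo.add_eq_zero] at h3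
  exact ⟨h3.symm, h2.symm, by rw [← h0, h3]⟩

/-- Closed loops in the domain have height zero along the boundary. -/
theorem ray_eq_zero_of_outside (Ω : SquareGridDomain) {G : Finset Edge} (hG : G ⊆ Ω.interior)
    {o : Face} (hv : Valid G o o) {f : Face} (hf : f ∉ Ω.faces) :
    ray G f.1 f.2 = 0 ∧ ray G (f.1 + 1) f.2 = 0 ∧ ray G f.1 (f.2 + 1) = 0 ∧
      ray G (f.1 + 1) (f.2 + 1) = 0 := by
  have hout : ∀ f ∉ Ω.faces, ∀ d, edgeOf f d ∉ G := fun f hf d h =>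
    hf (Ω.edgeOf_mem_interior.1 (hG h)).1
  have hcorner := fun f hf => hv.ray_corner (hout f hf)
  obtain ⟨N, hN⟩ := exists_height_bound G
  obtain ⟨M, hM⟩ := (Ω.faces.image Prod.snd).exists_le
  -- A face above both the domain and `G`, where the rays meet no edge.
  have hf0 : ((0, max N (M + 1)) : Face) ∉ Ω.faces := fun h => by
    have := hM _ (Finset.mem_image_of_mem _ h)
    simp only at this
    omega
  have key : ray G f.1 f.2 = 0 := by
    refine Ω.compl_induction (P := fun f => ray G f.1 f.2 = 0) hf0
      (ray_eq_zero_of_le hN _ _ (le_max_left _ _)) ?_ hf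
    intro f d hf hn h
    have h1 := hcorner f hf
    have h2 := hcorner _ hn
    fin_cases d
    · exact h1.1.trans h
    · exact h1.2.1.trans h
    · have := h2.1
      simp only [nbr, sub_add_cancel] at this ⊢
      rw [← this, h]
    · have := h2.2.1
      simp only [nbr, sub_add_cancel] at this ⊢
      rw [← this, h]
  have h1 := hcorner f hf
  exact ⟨key, h1.1.trans key, h1.2.1.trans key, h1.2.2.trans key⟩

/-! ### Configurations with a tip -/

theorem sum_ind_edgeOf (p f : Face) (e : Dir) :
    ∑ d, ind (edgeOf p e = edgeOf f d) = ind (f = p) + ind (f = nbr p e) := by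
  simp only [edgeOf_eq_iff]
  by_cases hp : f = p
  · subst hp
    simp [(nbr_ne f e).symm, ind]
  · by_cases hq : f = nbr p e
    · subst hq
      simp [nbr_ne p e, ind]
    · simp [hp, hq, ind]

/-- Toggling an edge changes the parity at its two faces, so the defect moves across it. -/
theorem Valid.toggle {G G' : Finset Edge} {p o : Face} {e : Dir} (hG : Valid G (nbr p e) o)
    (h : ∀ f, ind (f ∈ G') = ind (f ∈ G) + ind (edgeOf p e = f)) : Valid G' p o := by
  intro f
  rw [Finset.sum_congr rfl fun d _ => h _, Finset.sum_add_distrib, sum_ind_edgeOf, hG f]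
  have t : (2 : ZMod 2) = 0 := rfl
  linear_combination ind (f = nbr p e) * t

theorem Valid.erase_edge {G : Finset Edge} {p o : Face} {e : Dir} (hG : Valid G (nbr p e) o)
    (he : edgeOf p e ∈ G) : Valid (G.erase (edgeOf p e)) p o := by
  refine hG.toggle fun f => ?_
  unfold ind
  by_cases h1 : edgeOf p e = f
  · rw [← h1]
    simp [he, zmod_two_add_self]
  · simp [h1, Ne.symm h1]

theorem Valid.insert_edge {G : Finset Edge} {p o : Face} {e : Dir} (hG : Valid G (nbr p e) o)
    (he : edgeOf p e ∉ G) : Valid (insert (edgeOf p e) G) p o := by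
  refine hG.toggle fun f => ?_
  unfold ind
  by_cases h1 : edgeOf p e = f
  · rw [← h1]
    simp [he]
  · simp [h1, Ne.symm h1]

theorem valence_eq (γ : Finset Edge) (S : List Side) (p : Face) :
    valence γ S p = ∑ d, if Occupied γ S p d then 1 else 0 := by
  rw [valence, Finset.card_filter]

theorem even_valence_iff (γ : Finset Edge) (S : List Side) (p : Face) :
    Even (valence γ S p) ↔ ∑ d, ind (Occupied γ S p d) = 0 := by
  rw [← ZMod.natCast_eq_zero_iff_even, valence_eq]
  push_cast
  rfl

theorem SquareGridDomain.edgeOf_eq_iff_of_mem (Ω : SquareGridDomain) {s : Side}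
    (ho : nbr s.1 s.2 ∉ Ω.faces) {p : Face} (hp : p ∈ Ω.faces) (k : Dir) :
    edgeOf p k = edgeOf s.1 s.2 ↔ (p, k) = s := by
  rw [eq_comm, edgeOf_eq_iff]
  constructor
  · rintro (⟨h1, h2⟩ | ⟨h1, _⟩)
    · exact Prod.ext h1 h2
    · exact absurd (h1 ▸ hp) ho
  · rintro rfl
    exact Or.inl ⟨rfl, rfl⟩

theorem occupied_iff (Ω : SquareGridDomain) (γ : Finset Edge) {s t : Side}
    (ho : nbr s.1 s.2 ∉ Ω.faces) {p : Face} (hp : p ∈ Ω.faces) (k : Dir) :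
    Occupied γ [s, t] p k ↔ edgeOf p k ∈ insert (edgeOf s.1 s.2) γ ∨ (p, k) = t := by
  rw [Finset.mem_insert, Ω.edgeOf_eq_iff_of_mem ho hp]
  simp only [Occupied, List.mem_cons, List.not_mem_nil, or_false]
  tauto

theorem sum_ind_eq_side (p : Face) (t : Side) : ∑ k, ind ((p, k) = t) = ind (p = t.1) := by
  obtain ⟨q, e⟩ := t
  by_cases h : p = q <;> simp [h, ind]

theorem edgeOf_eq_of_side_eq {p : Face} {k : Dir} {t : Side} (h : (p, k) = t) :
    edgeOf p k = edgeOf t.1 t.2 := by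
  rw [← h]

theorem sum_ind_occupied (Ω : SquareGridDomain) (γ : Finset Edge) {s t : Side}
    (ho : nbr s.1 s.2 ∉ Ω.faces) (ht : edgeOf t.1 t.2 ∉ insert (edgeOf s.1 s.2) γ)
    {p : Face} (hp : p ∈ Ω.faces) :
    ∑ k, ind (Occupied γ [s, t] p k) =
      ∑ k, ind (edgeOf p k ∈ insert (edgeOf s.1 s.2) γ) + ind (p = t.1) := by
  rw [← sum_ind_eq_side, ← Finset.sum_add_distrib]
  refine Finset.sum_congr rfl fun k _ => ?_
  by_cases h : (p, k) = t
  · rw [ind_true ((occupied_iff Ω γ ho hp k).2 (Or.inr h)), ind_true h, ind_false, zero_add]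
    rwa [edgeOf_eq_of_side_eq h]
  · rw [ind_false h, add_zero]
    congr 1
    rw [occupied_iff Ω γ ho hp k]
    simp [h]

theorem sum_ind_outside (Ω : SquareGridDomain) {γ : Finset Edge} (hγ : γ ⊆ Ω.interior) {s : Side}
    (hs : s.1 ∈ Ω.faces) {p : Face} (hp : p ∉ Ω.faces) :
    ∑ k, ind (edgeOf p k ∈ insert (edgeOf s.1 s.2) γ) = ind (p = nbr s.1 s.2) := by
  have h : ∀ k, ind (edgeOf p k ∈ insert (edgeOf s.1 s.2) γ) =
      ind (edgeOf s.1 s.2 = edgeOf p k) := by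
    intro k
    rw [Finset.mem_insert, or_iff_left, eq_comm (a := edgeOf p k)]
    exact fun h => hp (Ω.edgeOf_mem_interior.1 (hγ h)).1
  rw [Finset.sum_congr rfl fun k _ => h k, sum_ind_edgeOf,
    ind_false (fun h : p = s.1 => hp (h ▸ hs)), zero_add]

/-- The start half-edge is completed to a full edge, which makes the outer face odd, and the tip
half-edge is dropped, which makes its face odd. The condition excluding the edge of `t` ensures that
the tip is not counted twice. -/
theorem valid_insert_iff (Ω : SquareGridDomain) {γ : Finset Edge} (hγ : γ ⊆ Ω.interior)
    {s t : Side} (hs : s.1 ∈ Ω.faces) (ho : nbr s.1 s.2 ∉ Ω.faces) (ht1 : t.1 ∈ Ω.faces)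
    (ht : edgeOf t.1 t.2 ∉ insert (edgeOf s.1 s.2) γ) :
    Valid (insert (edgeOf s.1 s.2) γ) t.1 (nbr s.1 s.2) ↔
      ∀ p ∈ Ω.faces, Even (valence γ [s, t] p) := by
  constructor
  · intro h p hp
    rw [even_valence_iff, sum_ind_occupied Ω γ ho ht hp, h p,
      ind_false (fun h : p = nbr s.1 s.2 => ho (h ▸ hp)), add_zero, zmod_two_add_self]
  · intro h p
    by_cases hp : p ∈ Ω.faces
    · have := h p hp
      rw [even_valence_iff, sum_ind_occupied Ω γ ho ht hp, CharTwo.add_eq_zero] at this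
      rw [this, ind_false (fun h : p = nbr s.1 s.2 => ho (h ▸ hp)), add_zero]
    · rw [sum_ind_outside Ω hγ hs hp, ind_false (fun h : p = t.1 => hp (h ▸ ht1)), zero_add]

theorem not_occupied_of_straight {γ : Finset Edge} {S : List Side} {p : Face} {d : Dir}
    (he : Even (valence γ S p)) (h4 : valence γ S p ≠ 4) (h0 : Occupied γ S p d)
    (h2 : Occupied γ S p (d + 2)) : ¬Occupied γ S p (d + 1) ∧ ¬Occupied γ S p (d + 3) := by
  rw [valence_eq, Fin.sum_univ_four] at he h4
  fin_cases d <;> simp only [Fin.zero_eta, Fin.mk_one, Fin.reduceFinMk, Fin.reduceAdd, zero_add]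
    at h0 h2 ⊢ <;>
    by_cases k0 : Occupied γ S p 0 <;> by_cases k1 : Occupied γ S p 1 <;>
    by_cases k2 : Occupied γ S p 2 <;> by_cases k3 : Occupied γ S p 3 <;>
    simp_all <;> revert he <;> decide

/-- The phase accumulated along a path is the ratio of the phases of the configurations at its
two ends. -/
theorem WalkIn.phase (Ω : SquareGridDomain) {ρ : ℤ → ℤ → ZMod 2} {γ : Finset Edge} {s t : Side}
    (hγ : γ ⊆ Ω.interior) (ho : nbr s.1 s.2 ∉ Ω.faces)
    (hρ : ∀ p ∈ Ω.faces, IsReference ρ (nbr s.1 s.2) p)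
    (hv : Valid (insert (edgeOf s.1 s.2) γ) t.1 (nbr s.1 s.2))
    (heven : ∀ p ∈ Ω.faces, Even (valence γ [s, t] p))
    (ht : edgeOf t.1 t.2 ∉ insert (edgeOf s.1 s.2) γ)
    {p : Face} {d : Dir} {ds : List Dir} (h : WalkIn γ s t p d ds) (hp : p ∈ Ω.faces)
    (hprev : edgeOf p (d + 2) ∈ insert (edgeOf s.1 s.2) γ)
    (hnd : (edgeOf p (d + 2) :: crossed p ds).Nodup) :
    Valid ((insert (edgeOf s.1 s.2) γ).filter (· ∉ crossed p ds)) p (nbr s.1 s.2) ∧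
      tipPhase ρ (insert (edgeOf s.1 s.2) γ) t =
        edgePhase ρ ((insert (edgeOf s.1 s.2) γ).filter (· ∉ crossed p ds)) p (d + 2) *
          Complex.exp (-(Complex.I / 2) * (winding d ds : ℂ)) := by
  set g := insert (edgeOf s.1 s.2) γ with hg
  have straight : ∀ (p : Face) (d e : Dir) (G : Finset Edge), p ∈ Ω.faces → G ⊆ g →
      edgeOf p (d + 2) ∈ g → Occupied γ [s, t] p e → (valence γ [s, t] p = 4 → e ≠ d) →
      e = d → edgeOf p (d + 1) ∉ G ∧ edgeOf p (d + 3) ∉ G := by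
    rintro p d e G hp hG hprev hocc hturn rfl
    have := not_occupied_of_straight (heven p hp) (fun h => hturn h rfl) hocc
      ((occupied_iff Ω γ ho hp _).2 (Or.inl hprev))
    rw [occupied_iff Ω γ ho hp, occupied_iff Ω γ ho hp, ← hg] at this
    exact ⟨fun h => this.1 (Or.inl (hG h)), fun h => this.2 (Or.inl (hG h))⟩
  have hpo : ∀ p ∈ Ω.faces, p ≠ nbr s.1 s.2 := fun p hp h => ho (h ▸ hp)
  -- At each stage the configuration consists of all edges except those still to be crossed, so its
  -- tip is at the current face.
  induction h with
  | last p d e hte hturn =>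
    have hz : edgeOf p e ∉ g := by rwa [edgeOf_eq_of_side_eq hte]
    -- The last edge reached carries only the tip half-edge and is not in `g`.
    have hfil : g.filter (· ∉ crossed p [e]) = g := by
      refine Finset.filter_true_of_mem fun x hx hx' => hz ?_
      simp only [crossed, List.mem_singleton] at hx'
      rwa [← hx']
    have hv' : Valid g p (nbr s.1 s.2) := by
      have : p = t.1 := by rw [← hte]
      rwa [this]
    rw [hfil]
    refine ⟨hv', ?_⟩
    have := edgePhase_step (hρ p hp) hv' (hpo p hp) hprev hz
      (straight p d e g hp subset_rfl hprev (Or.inr (by simp [hte])) hturn)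
    simp only [winding, add_zero]
    rw [← this, edgePhase, if_neg hz, hte]
  | step p d e ds hmem hturn htail ih =>
    have hp' : nbr p e ∈ Ω.faces := (Ω.edgeOf_mem_interior.1 (hγ hmem)).2
    have hmem' : edgeOf (nbr p e) (e + 2) ∈ g := by
      rw [edgeOf_nbr]
      exact Finset.mem_insert_of_mem hmem
    simp only [crossed] at hnd
    have hnd' : (edgeOf (nbr p e) (e + 2) :: crossed (nbr p e) ds).Nodup := by
      rw [edgeOf_nbr]
      exact (List.nodup_cons.1 hnd).2
    obtain ⟨hv1, hph⟩ := ih hp' hnd' hmem'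
    set G := g.filter (· ∉ crossed (nbr p e) ds) with hG
    have hGe : edgeOf p e ∈ G := by
      rw [edgeOf_nbr] at hmem' hnd'
      exact Finset.mem_filter.2 ⟨hmem', (List.nodup_cons.1 hnd').1⟩
    have hG' : g.filter (· ∉ crossed p (e :: ds)) = G.erase (edgeOf p e) := by
      ext x
      simp only [crossed, Finset.mem_filter, List.mem_cons, not_or, hG, Finset.mem_erase]
      tauto
    have hv2 := hv1.erase_edge hGe
    rw [hG']
    refine ⟨hv2, ?_⟩
    have hd : edgeOf p (d + 2) ∈ G.erase (edgeOf p e) := by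
      rw [← hG']
      exact Finset.mem_filter.2 ⟨hprev, (List.nodup_cons.1 hnd).1⟩
    have hne : edgeOf p e ∉ G.erase (edgeOf p e) := Finset.notMem_erase _ _
    have hstep := edgePhase_step (hρ p hp) hv2 (hpo p hp) hd hne
      (straight p d e _ hp ((Finset.erase_subset _ _).trans (Finset.filter_subset _ _)) hprev
        (Or.inl hmem) hturn)
    -- A tip at the midpoint of an edge has the same phase whether read from the face being left or
    -- from the face being entered.
    have e1 : edgePhase ρ G (nbr p e) (e + 2) = edgePhase ρ (G.erase (edgeOf p e)) p e := by
      rw [edgePhase, edgeOf_nbr, if_pos hGe, nbr_nbr, dir_add_two_add_two, edgePhase, if_neg hne]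
    rw [hph, e1, hstep, winding, mul_assoc, ← Complex.exp_add]
    push_cast
    ring_nf

/-- The phase of the empty configuration at the starting edge. -/
theorem tipPhase_start (Ω : SquareGridDomain) {ρ : ℤ → ℤ → ZMod 2} {G : Finset Edge} {s : Side}
    (hG : G ⊆ Ω.interior) (ho : nbr s.1 s.2 ∉ Ω.faces)
    (hv : Valid G (nbr s.1 s.2) (nbr s.1 s.2)) :
    tipPhase ρ G (nbr s.1 s.2, s.2 + 2) = tipPhase ρ ∅ (nbr s.1 s.2, s.2 + 2) := by
  obtain ⟨h1, h2, h3, h4⟩ := ray_eq_zero_of_outside Ω hG hv ho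
  have : ray G (leftVertex (nbr s.1 s.2, s.2 + 2)).1 (leftVertex (nbr s.1 s.2, s.2 + 2)).2 = 0 := by
    generalize s.2 + 2 = e
    fin_cases e <;> assumption
  unfold tipPhase height
  rw [this, ray, Finset.sum_empty]

/-- Erasing the whole walk leaves closed loops, whose phase at the start is that of the empty
configuration. The left side does not involve the path, so the exponential does not depend on it
either. -/
theorem IsPathWinding.phase (Ω : SquareGridDomain) {ρ : ℤ → ℤ → ZMod 2} {γ : Finset Edge}
    {s t : Side} (hγ : γ ⊆ Ω.interior) (hs : s.1 ∈ Ω.faces) (ho : nbr s.1 s.2 ∉ Ω.faces)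
    (hρ : ∀ p ∈ Ω.faces, IsReference ρ (nbr s.1 s.2) p) (ht1 : t.1 ∈ Ω.faces)
    (heven : ∀ p ∈ Ω.faces, Even (valence γ [s, t] p))
    (ht : edgeOf t.1 t.2 ∉ insert (edgeOf s.1 s.2) γ) {w : ℝ} (hw : IsPathWinding γ s t w) :
    tipPhase ρ (insert (edgeOf s.1 s.2) γ) t =
      tipPhase ρ ∅ (nbr s.1 s.2, s.2 + 2) * Complex.exp (-(Complex.I / 2) * (w : ℂ)) := by
  obtain ⟨ds, hwalk, hnd, rfl⟩ := hw
  have hv := (valid_insert_iff Ω hγ hs ho ht1 ht).2 heven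
  have hcross : ∀ {p d ds}, WalkIn γ s t p d ds → ∀ x ∈ crossed p ds, x ∈ γ ∨ x = edgeOf t.1 t.2 := by
    intro p d ds h
    induction h with
    | last p d e hte _ =>
      intro x hx
      simp only [crossed, List.mem_singleton] at hx
      exact Or.inr (hx.trans (edgeOf_eq_of_side_eq hte))
    | step p d e ds hmem _ _ ih =>
      intro x hx
      simp only [crossed, List.mem_cons] at hx
      rcases hx with rfl | hx
      · exact Or.inl hmem
      · exact ih x hx
  have ha : edgeOf s.1 s.2 ∉ γ := fun h => ho (Ω.edgeOf_mem_interior.1 (hγ h)).2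
  have hac : edgeOf s.1 s.2 ∉ crossed s.1 ds := fun h => by
    rcases hcross hwalk _ h with h | h
    · exact ha h
    · exact ht (h ▸ Finset.mem_insert_self _ _)
  have hnd' : (edgeOf s.1 (s.2 + 2 + 2) :: crossed s.1 ds).Nodup := by
    rw [dir_add_two_add_two]
    exact List.nodup_cons.2 ⟨hac, hnd⟩
  obtain ⟨hv1, hph⟩ := hwalk.phase Ω hγ ho hρ hv heven ht hs
    (by rw [dir_add_two_add_two]; exact Finset.mem_insert_self _ _) hnd'
  set G := (insert (edgeOf s.1 s.2) γ).filter (· ∉ crossed s.1 ds) with hG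
  have haG : edgeOf s.1 s.2 ∈ G := Finset.mem_filter.2 ⟨Finset.mem_insert_self _ _, hac⟩
  have hv2 : Valid (G.erase (edgeOf s.1 s.2)) (nbr s.1 s.2) (nbr s.1 s.2) := by
    have := Valid.erase_edge (p := nbr s.1 s.2) (e := s.2 + 2) (G := G) (o := nbr s.1 s.2)
    rw [edgeOf_nbr, nbr_nbr] at this
    exact this hv1 haG
  have hsub : G.erase (edgeOf s.1 s.2) ⊆ Ω.interior := by
    intro x hx
    rw [Finset.mem_erase, hG, Finset.mem_filter, Finset.mem_insert] at hx
    exact hγ (hx.2.1.resolve_left hx.1)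
  rw [hph, dir_add_two_add_two, edgePhase, if_pos haG, tipPhase_start Ω hsub ho hv2]

/-! ### Existence of admissible paths -/

theorem occupied_pair {γ : Finset Edge} {s t : Side} {p : Face} {k : Dir} :
    Occupied γ [s, t] p k ↔ edgeOf p k ∈ γ ∨ (p, k) = s ∨ (p, k) = t := by
  simp [Occupied]

theorem occupied_erase {δ : Finset Edge} {p : Face} {x e : Dir} {t : Side}
    (hs : edgeOf p x ∉ δ) (ht : edgeOf t.1 t.2 ∉ δ) (hst : (p, x) ≠ t) (he : edgeOf p e ∈ δ)
    (f : Face) (k : Dir) :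
    Occupied (δ.erase (edgeOf p e)) [(nbr p e, e + 2), t] f k ↔
      Occupied δ [(p, x), t] f k ∧ (f, k) ≠ (p, x) ∧ (f, k) ≠ (p, e) := by
  rw [occupied_pair, occupied_pair, Finset.mem_erase]
  constructor
  · rintro (⟨h1, h2⟩ | h | rfl)
    · refine ⟨Or.inl h2, ?_, ?_⟩
      · intro h
        obtain ⟨rfl, rfl⟩ := Prod.mk.inj h
        exact hs h2
      · intro h
        obtain ⟨rfl, rfl⟩ := Prod.mk.inj h
        exact h1 rfl
    · obtain ⟨rfl, rfl⟩ := Prod.mk.inj h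
      refine ⟨Or.inl (by rwa [edgeOf_nbr]), ?_, ?_⟩
      · intro h
        obtain ⟨h1, h2⟩ := Prod.mk.inj h
        rw [← h1, ← h2, edgeOf_nbr] at hs
        exact hs he
      · intro h
        exact nbr_ne p e (Prod.mk.inj h).1
    · refine ⟨Or.inr (Or.inr rfl), hst.symm, ?_⟩
      intro h
      obtain ⟨rfl, rfl⟩ := Prod.mk.inj h
      exact ht he
  · rintro ⟨h | h | h, h1, h2⟩
    · by_cases h3 : edgeOf f k = edgeOf p e
      · rcases (edgeOf_eq_iff p f e k).1 h3.symm with ⟨rfl, rfl⟩ | ⟨rfl, rfl⟩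
        · exact absurd rfl h2
        · exact Or.inr (Or.inl rfl)
      · exact Or.inl ⟨h3, h⟩
    · exact absurd h h1
    · exact Or.inr (Or.inr h)

theorem dir_add_one_ne : ∀ k : Dir, k + 1 ≠ k + 2 ∧ k + 1 ≠ k := by decide

theorem dir_opposite_of_left : ∀ d e k : Dir,
    e ≠ d + 2 → k ≠ e → k + 2 ≠ e → k + 1 = d + 2 → e = d := by
  decide

theorem dir_opposite_of_right : ∀ d e k : Dir,
    e ≠ d + 2 → k ≠ d + 2 → k + 2 ≠ d + 2 → k + 1 = e → e = d := by
  decide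

/-- A greedy walk: `δ` holds the unused edges and `(p, d + 2)` is the half-edge just traversed.
Parity always provides an exit, and `δ` shrinks, so the walk must end at `t`. The last hypothesis is
the invariant that saves the turning rule: at a face of valence four the unused half-edges are never
just an opposite pair. -/
theorem exists_walkIn {γ : Finset Edge} {s t : Side} (δ : Finset Edge) :
    ∀ (p : Face) (d : Dir), δ ⊆ γ →
      edgeOf p (d + 2) ∉ δ → edgeOf t.1 t.2 ∉ δ → (p, d + 2) ≠ t →
      (∀ f, Even (valence δ [(p, d + 2), t] f)) →
      (∀ f, valence γ [s, t] f = 4 → ∀ k, Occupied δ [(p, d + 2), t] f k →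
        Occupied δ [(p, d + 2), t] f (k + 2) → Occupied δ [(p, d + 2), t] f (k + 1)) →
      ∃ ds, WalkIn γ s t p d ds ∧ (crossed p ds).Nodup ∧
        ∀ x ∈ crossed p ds, x ∈ δ ∨ x = edgeOf t.1 t.2 := by
  induction δ using Finset.strongInduction with
  | H δ ih =>
  intro p d hδ hs ht hst heven hstr
  have hocc : Occupied δ [(p, d + 2), t] p (d + 2) := occupied_pair.2 (Or.inr (Or.inl rfl))
  obtain ⟨k, hk, hkocc⟩ : ∃ k, k ≠ d + 2 ∧ Occupied δ [(p, d + 2), t] p k := by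
    by_contra! hcon
    have := (even_valence_iff _ _ _).1 (heven p)
    rw [Finset.sum_eq_single (d + 2) (fun k _ hk => ind_false (hcon k hk)) (by simp),
      ind_true hocc] at this
    exact one_ne_zero this
  obtain ⟨e, he, heocc, hturn⟩ : ∃ e, e ≠ d + 2 ∧ Occupied δ [(p, d + 2), t] p e ∧
      (valence γ [s, t] p = 4 → e ≠ d) := by
    by_cases h : valence γ [s, t] p = 4 ∧ k = d
    · obtain ⟨h4, rfl⟩ := h
      -- The exit found by parity is straight ahead; the invariant offers a turn instead.
      refine ⟨k + 1, ?_, hstr p h4 k hkocc hocc, fun _ => ?_⟩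
      · exact (dir_add_one_ne k).1
      · exact (dir_add_one_ne k).2
    · exact ⟨k, hk, hkocc, fun h4 hkd => h ⟨h4, hkd⟩⟩
  by_cases hte : (p, e) = t
  · refine ⟨[e], WalkIn.last p d e hte hturn, by simp [crossed], fun x hx => Or.inr ?_⟩
    simp only [crossed, List.mem_singleton] at hx
    exact hx.trans (edgeOf_eq_of_side_eq hte)
  have hmem : edgeOf p e ∈ δ := by
    rcases occupied_pair.1 heocc with h | h | h
    · exact h
    · exact absurd (Prod.mk.inj h).2 he
    · exact absurd h hte
  have hO := occupied_erase hs ht hst hmem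
  have heven' : ∀ f, Even (valence (δ.erase (edgeOf p e)) [(nbr p e, e + 2), t] f) := by
    intro f
    have h : ∀ k, ind (Occupied (δ.erase (edgeOf p e)) [(nbr p e, e + 2), t] f k) =
        ind (Occupied δ [(p, d + 2), t] f k) + (ind ((f, k) = (p, d + 2)) +
          ind ((f, k) = (p, e))) := by
      intro k
      have t2 : (1 : ZMod 2) + 1 = 0 := rfl
      by_cases h1 : (f, k) = (p, d + 2)
      · obtain ⟨rfl, rfl⟩ := Prod.mk.inj h1
        simp [ind, hO, hocc, he.symm, t2]
      · by_cases h2 : (f, k) = (p, e)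
        · obtain ⟨rfl, rfl⟩ := Prod.mk.inj h2
          simp [ind, hO, heocc, he, t2]
        · simp only [hO, h1, h2, ne_eq, not_false_eq_true, and_true]
          simp [ind]
    rw [even_valence_iff, Finset.sum_congr rfl fun k _ => h k, Finset.sum_add_distrib,
      Finset.sum_add_distrib, sum_ind_eq_side, sum_ind_eq_side,
      (even_valence_iff _ _ _).1 (heven f)]
    simp only [zmod_two_add_self, add_zero]
  obtain ⟨ds, h1, h2, h3⟩ := ih (δ.erase (edgeOf p e)) (Finset.erase_ssubset hmem) (nbr p e) e
    ((Finset.erase_subset _ _).trans hδ)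
    (by rw [edgeOf_nbr]; exact Finset.notMem_erase _ _)
    (fun h => ht (Finset.mem_of_mem_erase h))
    (fun h => ht (by rw [← h, edgeOf_nbr]; exact hmem)) heven' (by
      -- If `k` and `k + 2` survive but `k + 1` was used in this step, the entry and exit would be
      -- the opposite pair `k + 1`, `k + 3`, contrary to the turn just made.
      intro f h4 k hk1 hk2
      rw [hO] at hk1 hk2 ⊢
      refine ⟨hstr f h4 k hk1.1 hk2.1, ?_, ?_⟩
      · intro h
        obtain rfl := (Prod.mk.inj h).1
        have a1 : k ≠ e := fun h => hk1.2.2 (by rw [h])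
        have a2 : k + 2 ≠ e := fun h => hk2.2.2 (by rw [h])
        exact hturn h4 (dir_opposite_of_left d e k he a1 a2 (Prod.mk.inj h).2)
      · intro h
        obtain rfl := (Prod.mk.inj h).1
        have a1 : k ≠ d + 2 := fun h => hk1.2.1 (by rw [h])
        have a2 : k + 2 ≠ d + 2 := fun h => hk2.2.1 (by rw [h])
        exact hturn h4 (dir_opposite_of_right d e k he a1 a2 (Prod.mk.inj h).2))
  refine ⟨e :: ds, WalkIn.step p d e ds (hδ hmem) hturn h1, ?_, ?_⟩
  · refine List.nodup_cons.2 ⟨fun h => ?_, h2⟩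
    rcases h3 _ h with h | h
    · exact Finset.notMem_erase _ _ h
    · exact ht (h ▸ hmem)
  · intro x hx
    rcases List.mem_cons.1 hx with rfl | hx
    · exact Or.inl hmem
    · exact (h3 x hx).imp Finset.mem_of_mem_erase id

theorem exists_isPathWinding {γ : Finset Edge} {s t : Side} (hs : edgeOf s.1 s.2 ∉ γ)
    (ht : edgeOf t.1 t.2 ∉ γ) (hst : s ≠ t) (heven : ∀ f, Even (valence γ [s, t] f)) :
    ∃ w, IsPathWinding γ s t w := by
  have e1 : (s.1, s.2 + 2 + 2) = s := by rw [dir_add_two_add_two]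
  obtain ⟨ds, h1, h2, _⟩ := exists_walkIn (γ := γ) (s := s) (t := t) γ s.1 (s.2 + 2)
    subset_rfl (by rwa [dir_add_two_add_two]) ht (by rwa [e1]) (by rwa [e1]) (by
      rw [e1]
      intro f h4 k _ _
      have : Finset.univ.filter (fun d : Dir => Occupied γ [s, t] f d) = Finset.univ :=
        Finset.eq_univ_of_card _ h4
      have h := Finset.mem_univ (k + 1)
      rw [← this] at h
      exact (Finset.mem_filter.1 h).2)
  exact ⟨_, ds, h1, h2, rfl⟩

theorem pathWinding_phase (Ω : SquareGridDomain) {ρ : ℤ → ℤ → ZMod 2} {γ : Finset Edge}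
    {s t : Side} (hγ : γ ⊆ Ω.interior) (hs : s.1 ∈ Ω.faces) (ho : nbr s.1 s.2 ∉ Ω.faces)
    (hρ : ∀ p ∈ Ω.faces, IsReference ρ (nbr s.1 s.2) p) (ht1 : t.1 ∈ Ω.faces)
    (heven : ∀ p ∈ Ω.faces, Even (valence γ [s, t] p))
    (ht : edgeOf t.1 t.2 ∉ insert (edgeOf s.1 s.2) γ) :
    tipPhase ρ (insert (edgeOf s.1 s.2) γ) t =
      tipPhase ρ ∅ (nbr s.1 s.2, s.2 + 2) *
        Complex.exp (-(Complex.I / 2) * (pathWinding γ s t : ℂ)) := by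
  have hst : s ≠ t := fun h => ht (by rw [h]; exact Finset.mem_insert_self _ _)
  have hex : ∃ w, IsPathWinding γ s t w := by
    refine exists_isPathWinding (fun h => ho (Ω.edgeOf_mem_interior.1 (hγ h)).2)
      (fun h => ht (Finset.mem_insert_of_mem h)) hst fun f => ?_
    by_cases hf : f ∈ Ω.faces
    · exact heven f hf
    · rw [even_valence_iff]
      refine Finset.sum_eq_zero fun k _ => ind_false ?_
      rw [occupied_pair]
      rintro (h | h | h)
      · exact hf (Ω.edgeOf_mem_interior.1 (hγ h)).1
      · exact hf (by rw [← h] at hs; exact hs)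
      · exact hf (by rw [← h] at ht1; exact ht1)
  rw [pathWinding, dif_pos hex]
  exact hex.choose_spec.phase Ω hγ hs ho hρ ht1 heven ht

/-! ### The observable as a sum over configurations with a tip -/

/-- The weight `e ^ (-2 β)` at the critical point. -/
def alphaC : ℝ := Real.exp (-2 * betaC)

theorem alphaC_eq : alphaC = √2 - 1 := by
  have h : (0 : ℝ) < √2 + 1 := by positivity
  have h1 : -2 * betaC = -Real.log (√2 + 1) := by rw [betaC]; ring
  rw [alphaC, h1, Real.exp_neg, Real.exp_log h, inv_eq_iff_eq_inv, eq_comm]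
  refine inv_eq_of_mul_eq_one_left ?_
  have := Real.sq_sqrt (zero_le_two (α := ℝ))
  linear_combination this

theorem alphaC_mul : alphaC * (√2 + 1) = 1 := by
  rw [alphaC_eq]
  have := Real.sq_sqrt (zero_le_two (α := ℝ))
  linear_combination this

theorem partitionFunction_pos (β : ℝ) (Ω : SquareGridDomain) : 0 < partitionFunction β Ω := by
  refine Finset.sum_pos (fun ω _ => pow_pos (Real.exp_pos _) _) ⟨∅, ?_⟩
  refine Finset.mem_filter.2 ⟨Finset.empty_mem_powerset _, fun p _ => ?_⟩
  simp [valence, Occupied]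

/-- The configurations in the domain, starting along `s`, whose tip is a half-edge at `q`. -/
def configs (Ω : SquareGridDomain) (s : Side) (q : Face) : Finset (Finset Edge) :=
  (insert (edgeOf s.1 s.2) Ω.interior).powerset.filter fun G => Valid G q (nbr s.1 s.2)

/-- The weighted phases of the configurations with tip `t`. -/
def tipSum (Ω : SquareGridDomain) (ρ : ℤ → ℤ → ZMod 2) (s t : Side) : ℂ :=
  ∑ G ∈ (configs Ω s t.1).filter (fun G => edgeOf t.1 t.2 ∉ G),
    ((alphaC ^ G.card : ℝ) : ℂ) * tipPhase ρ G t

/-- The weighted phases at the side `d` of `p` of the configurations with an odd valence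
at `p`. -/
def faceSum (Ω : SquareGridDomain) (ρ : ℤ → ℤ → ZMod 2) (s : Side) (p : Face) (d : Dir) : ℂ :=
  ∑ G ∈ configs Ω s p, ((alphaC ^ G.card : ℝ) : ℂ) *
    ((sideWeight G (edgeOf p d) : ℂ) * edgePhase ρ G p d)

theorem mem_configs {Ω : SquareGridDomain} {s : Side} {q : Face} {G : Finset Edge} :
    G ∈ configs Ω s q ↔
      G ⊆ insert (edgeOf s.1 s.2) Ω.interior ∧ Valid G q (nbr s.1 s.2) := by
  rw [configs, Finset.mem_filter, Finset.mem_powerset]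

theorem eta_ne_zero (d : Dir) : eta d ≠ 0 := by
  fin_cases d <;> simp [eta, lam_ne_zero]

theorem sgn_ne_zero (x : ZMod 2) : sgn x ≠ 0 := by
  unfold sgn; split_ifs <;> simp

theorem tipPhase_ne_zero (ρ : ℤ → ℤ → ZMod 2) (G : Finset Edge) (t : Side) :
    tipPhase ρ G t ≠ 0 := mul_ne_zero (eta_ne_zero _) (sgn_ne_zero _)

section Observable

variable {Ω : SquareGridDomain} {s : Side}

theorem start_mem_of_mem_configs (ho : nbr s.1 s.2 ∉ Ω.faces) {q : Face} (hq : q ∈ Ω.faces)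
    {G : Finset Edge} (hG : G ∈ configs Ω s q) : edgeOf s.1 s.2 ∈ G := by
  obtain ⟨hsub, hv⟩ := mem_configs.1 hG
  by_contra ha
  have h := hv (nbr s.1 s.2)
  rw [ind_true rfl, ind_false (fun h : nbr s.1 s.2 = q => ho (h ▸ hq)),
    Finset.sum_eq_zero] at h
  · exact absurd h (by decide)
  · refine fun d _ => ind_false fun hd => ?_
    rcases Finset.mem_insert.1 (hsub hd) with h1 | h1
    · exact ha (h1 ▸ hd)
    · exact ho (Ω.edgeOf_mem_interior.1 h1).1

theorem start_notMem_interior (ho : nbr s.1 s.2 ∉ Ω.faces) : edgeOf s.1 s.2 ∉ Ω.interior :=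
  fun h => ho (Ω.edgeOf_mem_interior.1 h).2

theorem mem_evenCollections {S : List Side} {γ : Finset Edge} :
    γ ∈ evenCollections Ω S ↔ γ ⊆ Ω.interior ∧ ∀ p ∈ Ω.faces, Even (valence γ S p) := by
  rw [evenCollections, Finset.mem_filter, Finset.mem_powerset]

/-- Adjoining the start edge is a bijection onto the configurations with tip `t`; it accounts for
the exponent `|γ| + 1`. -/
theorem sum_pathWinding (hs : s.1 ∈ Ω.faces) (ho : nbr s.1 s.2 ∉ Ω.faces)
    {ρ : ℤ → ℤ → ZMod 2} (hρ : ∀ p ∈ Ω.faces, IsReference ρ (nbr s.1 s.2) p)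
    {t : Side} (ht1 : t.1 ∈ Ω.faces) (hne : edgeOf t.1 t.2 ≠ edgeOf s.1 s.2) :
    tipPhase ρ ∅ (nbr s.1 s.2, s.2 + 2) *
      ∑ γ ∈ (evenCollections Ω [s, t]).filter (fun γ => edgeOf t.1 t.2 ∉ γ),
        ((alphaC ^ (γ.card + 1) : ℝ) : ℂ) *
          Complex.exp (-(Complex.I / 2) * (pathWinding γ s t : ℂ)) = tipSum Ω ρ s t := by
  rw [tipSum, Finset.mul_sum]
  have ha := start_notMem_interior ho
  refine Finset.sum_bij' (fun γ _ => insert (edgeOf s.1 s.2) γ) (fun G _ => G.erase (edgeOf s.1 s.2))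
    ?_ ?_ ?_ ?_ ?_
  · intro γ hγ
    obtain ⟨h1, h2⟩ := Finset.mem_filter.1 hγ
    obtain ⟨h3, h4⟩ := mem_evenCollections.1 h1
    have hz : edgeOf t.1 t.2 ∉ insert (edgeOf s.1 s.2) γ := by
      rw [Finset.mem_insert, not_or]; exact ⟨hne, h2⟩
    exact Finset.mem_filter.2 ⟨mem_configs.2 ⟨Finset.insert_subset_insert _ h3,
      (valid_insert_iff Ω h3 hs ho ht1 hz).2 h4⟩, hz⟩
  · intro G hG
    obtain ⟨h1, h2⟩ := Finset.mem_filter.1 hG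
    obtain ⟨h3, h4⟩ := mem_configs.1 h1
    have hmem := start_mem_of_mem_configs ho ht1 h1
    have hsub : G.erase (edgeOf s.1 s.2) ⊆ Ω.interior :=
      Finset.subset_insert_iff.1 h3
    refine Finset.mem_filter.2 ⟨mem_evenCollections.2 ⟨hsub, ?_⟩,
      fun h => h2 (Finset.mem_of_mem_erase h)⟩
    refine (valid_insert_iff Ω hsub hs ho ht1 ?_).1 ?_ <;> rwa [Finset.insert_erase hmem]
  · intro γ hγ
    have h3 := (mem_evenCollections.1 (Finset.mem_filter.1 hγ).1).1
    exact Finset.erase_insert fun h => ha (h3 h)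
  · intro G hG
    exact Finset.insert_erase (start_mem_of_mem_configs ho ht1 (Finset.mem_filter.1 hG).1)
  · intro γ hγ
    obtain ⟨h1, h2⟩ := Finset.mem_filter.1 hγ
    obtain ⟨h3, h4⟩ := mem_evenCollections.1 h1
    have hz : edgeOf t.1 t.2 ∉ insert (edgeOf s.1 s.2) γ := by
      rw [Finset.mem_insert, not_or]; exact ⟨hne, h2⟩
    rw [pathWinding_phase Ω h3 hs ho hρ ht1 h4 hz, Finset.card_insert_of_notMem fun h => ha (h3 h)]
    ring

theorem sum_notMem_edgePhase (ρ : ℤ → ℤ → ZMod 2) (p : Face) (d : Dir) :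
    ∑ G ∈ (configs Ω s p).filter (fun G => edgeOf p d ∉ G), ((alphaC ^ G.card : ℝ) : ℂ) *
      ((sideWeight G (edgeOf p d) : ℂ) * edgePhase ρ G p d) = tipSum Ω ρ s (p, d) := by
  refine Finset.sum_congr rfl fun G hG => ?_
  have h := (Finset.mem_filter.1 hG).2
  rw [sideWeight, if_neg h, edgePhase, if_neg h]
  simp

theorem alphaC_pow_card {G : Finset Edge} {e : Edge} (h : e ∈ G) :
    alphaC ^ G.card * sideWeight G e = alphaC ^ (G.erase e).card := by
  rw [sideWeight, if_pos h, ← Finset.card_erase_add_one h, pow_succ, mul_assoc, alphaC_mul, mul_one]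

/-- Erasing the side moves the tip to the neighbouring face, and the factor `√2 + 1 = 1 / α`
restores the weight of the smaller configuration. -/
theorem sum_mem_edgePhase (ρ : ℤ → ℤ → ZMod 2) (p : Face) (d : Dir)
    (hz : edgeOf p d ∈ insert (edgeOf s.1 s.2) Ω.interior) :
    ∑ G ∈ (configs Ω s p).filter (fun G => edgeOf p d ∈ G), ((alphaC ^ G.card : ℝ) : ℂ) *
      ((sideWeight G (edgeOf p d) : ℂ) * edgePhase ρ G p d) =
        tipSum Ω ρ s (nbr p d, d + 2) := by
  rw [tipSum, edgeOf_nbr]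
  refine Finset.sum_bij' (fun G _ => G.erase (edgeOf p d)) (fun G _ => insert (edgeOf p d) G)
    ?_ ?_ ?_ ?_ ?_
  · intro G hG
    obtain ⟨h1, h2⟩ := Finset.mem_filter.1 hG
    obtain ⟨h3, h4⟩ := mem_configs.1 h1
    have := Valid.erase_edge (p := nbr p d) (e := d + 2) (G := G) (o := nbr s.1 s.2)
    rw [edgeOf_nbr, nbr_nbr] at this
    exact Finset.mem_filter.2 ⟨mem_configs.2 ⟨(Finset.erase_subset _ _).trans h3, this h4 h2⟩,
      Finset.notMem_erase _ _⟩
  · intro G hG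
    obtain ⟨h1, h2⟩ := Finset.mem_filter.1 hG
    obtain ⟨h3, h4⟩ := mem_configs.1 h1
    exact Finset.mem_filter.2 ⟨mem_configs.2 ⟨Finset.insert_subset hz h3, h4.insert_edge h2⟩,
      Finset.mem_insert_self _ _⟩
  · intro G hG
    exact Finset.insert_erase (Finset.mem_filter.1 hG).2
  · intro G hG
    exact Finset.erase_insert (Finset.mem_filter.1 hG).2
  · intro G hG
    have h := (Finset.mem_filter.1 hG).2
    rw [← mul_assoc, ← Complex.ofReal_mul, alphaC_pow_card h, edgePhase, if_pos h]

theorem valid_iff_even {ω : Finset Edge} (hω : ω ⊆ Ω.interior) (o : Face) :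
    Valid ω o o ↔ ∀ p ∈ Ω.faces, Even (valence ω [] p) := by
  have h : ∀ p, Even (valence ω [] p) ↔ ∑ d, ind (edgeOf p d ∈ ω) = 0 := by
    intro p
    rw [even_valence_iff]
    simp [Occupied]
  simp only [h, Valid, zmod_two_add_self]
  refine ⟨fun h p _ => h p, fun h p => ?_⟩
  by_cases hp : p ∈ Ω.faces
  · exact h p hp
  · exact Finset.sum_eq_zero fun d _ =>
      ind_false fun hd => hp (Ω.edgeOf_mem_interior.1 (hω hd)).1

/-- With the tip outside, at the start edge, only closed loops remain, all with the same phase. This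
produces the partition function and matches the convention `f(a, a) = 1`. -/
theorem tipSum_start (ho : nbr s.1 s.2 ∉ Ω.faces) (ρ : ℤ → ℤ → ZMod 2) :
    tipSum Ω ρ s (nbr s.1 s.2, s.2 + 2) =
      tipPhase ρ ∅ (nbr s.1 s.2, s.2 + 2) * (partitionFunction betaC Ω : ℂ) := by
  have : (configs Ω s (nbr s.1 s.2)).filter (fun G => edgeOf s.1 s.2 ∉ G) =
      evenCollections Ω [] := by
    ext G
    rw [Finset.mem_filter, mem_configs, mem_evenCollections]
    constructor
    · rintro ⟨⟨h1, h2⟩, h3⟩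
      have h4 := (Finset.subset_insert_iff_of_notMem h3).1 h1
      exact ⟨h4, (valid_iff_even h4 _).1 h2⟩
    · rintro ⟨h1, h2⟩
      exact ⟨⟨h1.trans (Finset.subset_insert _ _), (valid_iff_even h1 _).2 h2⟩,
        fun h => start_notMem_interior ho (h1 h)⟩
  rw [tipSum, edgeOf_nbr, this, partitionFunction, Complex.ofReal_sum, Finset.mul_sum]
  refine Finset.sum_congr rfl fun G hG => ?_
  obtain ⟨h1, h2⟩ := mem_evenCollections.1 hG
  rw [tipPhase_start Ω h1 ho ((valid_iff_even h1 _).2 h2), mul_comm, alphaC]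

/-- The observable at the sides of a face, as a sum over configurations at that face. -/
theorem observable_eq_faceSum (hs : s.1 ∈ Ω.faces) (ho : nbr s.1 s.2 ∉ Ω.faces)
    {ρ : ℤ → ℤ → ZMod 2} (hρ : ∀ p ∈ Ω.faces, IsReference ρ (nbr s.1 s.2) p)
    {p : Face} (hp : p ∈ Ω.faces) (d : Dir) :
    tipPhase ρ ∅ (nbr s.1 s.2, s.2 + 2) * (partitionFunction betaC Ω : ℂ) *
      observable betaC Ω (edgeOf s.1 s.2) (edgeOf p d) = faceSum Ω ρ s p d := by
  have hZ : (partitionFunction betaC Ω : ℂ) ≠ 0 :=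
    Complex.ofReal_ne_zero.2 (partitionFunction_pos _ _).ne'
  rw [faceSum, ← Finset.sum_filter_add_sum_filter_not _ (fun G => edgeOf p d ∈ G)]
  by_cases hz : edgeOf p d = edgeOf s.1 s.2
  · obtain rfl := (Ω.edgeOf_eq_iff_of_mem ho hp d).1 hz
    rw [observable, if_pos rfl, mul_one, sum_mem_edgePhase ρ p d (Finset.mem_insert_self _ _),
      tipSum_start ho, Finset.filter_false_of_mem, Finset.sum_empty, add_zero]
    exact fun G hG h => h (start_mem_of_mem_configs ho hp hG)
  · rw [observable, if_neg hz, Ω.innerSide_edgeOf hs ho, sum_notMem_edgePhase]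
    have key : ∀ t ∈ Ω.sidesAt (edgeOf p d),
        tipPhase ρ ∅ (nbr s.1 s.2, s.2 + 2) *
          ∑ γ ∈ (evenCollections Ω [s, t]).filter (fun γ => edgeOf p d ∉ γ),
            ((Real.exp (-2 * betaC) ^ (γ.card + 1) : ℝ) : ℂ) *
              Complex.exp (-(Complex.I / 2) * (pathWinding γ s t : ℂ)) = tipSum Ω ρ s t := by
      intro t ht
      obtain ⟨h1, h2⟩ := Ω.mem_sidesAt.1 ht
      rw [← h2]
      exact sum_pathWinding hs ho hρ h1 (by rwa [h2])
    have hassoc : ∀ x y z : ℂ, y ≠ 0 → x * y * (y⁻¹ * z) = x * z := by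
      intro x y z hy
      field_simp
    rw [hassoc _ _ _ hZ, Finset.mul_sum, Finset.sum_congr rfl key]
    by_cases hn : nbr p d ∈ Ω.faces
    · rw [sum_mem_edgePhase ρ p d (Finset.mem_insert_of_mem (Ω.edgeOf_mem_interior.2 ⟨hp, hn⟩)),
        Ω.sidesAt_edgeOf_of_mem hp hn, Finset.sum_pair, add_comm]
      exact fun h => nbr_ne p d (Prod.mk.inj h).1.symm
    -- A boundary edge other than the start lies in no configuration, so only the half-edge from
    -- inside contributes.
    · rw [Ω.sidesAt_edgeOf_of_notMem hp hn, Finset.sum_singleton, Finset.filter_false_of_mem,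
        Finset.sum_empty, zero_add]
      intro G hG h
      rcases Finset.mem_insert.1 ((mem_configs.1 hG).1 h) with h | h
      · exact hz h
      · exact hn (Ω.edgeOf_mem_interior.1 h).2

theorem sHolAt_faceSum (ho : nbr s.1 s.2 ∉ Ω.faces)
    {ρ : ℤ → ℤ → ZMod 2} (hρ : ∀ p ∈ Ω.faces, IsReference ρ (nbr s.1 s.2) p)
    {p : Face} (hp : p ∈ Ω.faces) : SHolAt fun d => lam * faceSum Ω ρ s p d := by
  have := SHolAt.sum (configs Ω s p) (fun G d => ((alphaC ^ G.card : ℝ) : ℂ) *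
    ((sideWeight G (edgeOf p d) : ℂ) * (lam * edgePhase ρ G p d))) fun G hG =>
      (sHolAt_edgePhase (hρ p hp) (mem_configs.1 hG).2
        (fun h => ho (h ▸ hp))).smul (alphaC ^ G.card)
  convert this using 1
  ext d
  rw [faceSum, Finset.mul_sum, Finset.sum_apply]
  exact Finset.sum_congr rfl fun G _ => by ring

end Observable

/-! ### Lines and tangents -/

theorem cpow_neg_half_sq_mul {τ : ℂ} (hτ : τ ≠ 0) : (τ ^ (-(1 / 2) : ℂ)) ^ 2 * τ = 1 := by
  rw [← Complex.cpow_nat_mul]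
  have : ((2 : ℕ) : ℂ) * (-(1 / 2)) = -1 := by push_cast; ring
  rw [this, Complex.cpow_neg_one, inv_mul_cancel₀ hτ]

theorem exists_real_mul_of_sq_mul {τ w v : ℂ} (hτ : τ ≠ 0) (hv : v ^ 2 * τ = 1) {r : ℝ}
    (hr : 0 ≤ r) (hw : w ^ 2 * τ = r) : ∃ x : ℝ, w = x * v := by
  have hs : ((√r : ℝ) : ℂ) ^ 2 = r := by rw [← Complex.ofReal_pow, Real.sq_sqrt hr]
  have h1 : w ^ 2 = (((√r : ℝ) : ℂ) * v) ^ 2 := by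
    refine mul_right_cancel₀ hτ ?_
    rw [hw]
    linear_combination -(r : ℂ) * hv - (v ^ 2 * τ) * hs
  rcases sq_eq_sq_iff_eq_or_eq_neg.1 h1 with h2 | h2
  · exact ⟨√r, h2⟩
  · exact ⟨-√r, by rw [h2]; push_cast; ring⟩

/-- Squaring removes the choice of the branch of `τ ^ (-1/2)`. -/
theorem mem_lineOf_iff {τ w : ℂ} (hτ : τ ≠ 0) :
    w ∈ lineOf τ ↔ ∃ r : ℝ, 0 ≤ r ∧ w ^ 2 * τ = r := by
  have hv := cpow_neg_half_sq_mul hτ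
  rw [lineOf, Submodule.mem_span_singleton]
  constructor
  · rintro ⟨x, rfl⟩
    refine ⟨x ^ 2, sq_nonneg x, ?_⟩
    rw [Complex.real_smul]
    push_cast
    linear_combination (x : ℂ) ^ 2 * hv
  · rintro ⟨r, hr, h⟩
    obtain ⟨x, hx⟩ := exists_real_mul_of_sq_mul hτ hv hr h
    exact ⟨x, by rw [hx, Complex.real_smul]⟩

theorem exists_real_mul_of_mem_lineOf {τ w v : ℂ} (hτ : τ ≠ 0) (hw : w ∈ lineOf τ)
    (hv : v ^ 2 * τ = 1) : ∃ x : ℝ, w = x * v := by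
  obtain ⟨r, hr, h⟩ := (mem_lineOf_iff hτ).1 hw
  exact exists_real_mul_of_sq_mul hτ hv hr h

theorem dirVec_ne_zero (d : Dir) : dirVec d ≠ 0 := pow_ne_zero _ Complex.I_ne_zero

theorem dirVec_add_two (d : Dir) : dirVec (d + 2) = -dirVec d := by
  have h := Complex.I_sq
  have h3 : Complex.I ^ 3 = -Complex.I := by rw [pow_succ, h]; ring
  fin_cases d <;> simp [dirVec, h3]

theorem lam_eta_sq (d : Dir) : (lam * eta d) ^ 2 * dirVec d = Complex.I := by
  have h := Complex.I_sq
  have h3 : Complex.I ^ 3 = -Complex.I := by rw [pow_succ, h]; ring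
  have hl := lam_sq
  have hi := lam_mul_inv
  fin_cases d <;> simp [dirVec, eta, h3] <;> grind

namespace SquareGridDomain

variable (Ω : SquareGridDomain)

theorem tauCw_ne_zero (e : Edge) : Ω.tauCw e ≠ 0 :=
  mul_ne_zero (neg_ne_zero.2 Complex.I_ne_zero) (dirVec_ne_zero _)

theorem tauCcw_ne_zero (e : Edge) : Ω.tauCcw e ≠ 0 := neg_ne_zero.2 (Ω.tauCw_ne_zero e)

end SquareGridDomain

/-! ### Uniqueness -/

/-- For `μ` on the unit circle `w + μ * conj w` lies on a fixed real line, here never the imaginary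
axis, so the real part carries the whole relation. The constant `√2 - 1` is `tan (π / 8)`. -/
theorem SHolAt.re_eq {X : Dir → ℂ} (h : SHolAt X) :
    (X 1).re + (√2 - 1) * (X 1).im = (X 0).re + (√2 - 1) * (X 0).im ∧
    (X 1).re - (√2 - 1) * (X 1).im = (X 2).re - (√2 - 1) * (X 2).im ∧
    (√2 - 1) * (X 3).re + (X 3).im = (√2 - 1) * (X 0).re + (X 0).im ∧
    (√2 - 1) * (X 3).re - (X 3).im = (√2 - 1) * (X 2).re - (X 2).im := by
  obtain ⟨h1, h2, h3, h4⟩ := h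
  rw [lam_cube] at h3
  rw [lam_cube_inv] at h4
  rw [lam_eq] at h1
  rw [lam_inv] at h2
  have hs := Real.sq_sqrt (zero_le_two (α := ℝ))
  have k1 := congrArg Complex.re h1
  have k2 := congrArg Complex.re h2
  have k3 := congrArg Complex.re h3
  have k4 := congrArg Complex.re h4
  simp at k1 k2 k3 k4
  refine ⟨?_, ?_, ?_, ?_⟩ <;> grind

/-- The four projections shared by adjacent sides determine all four values, and in these
coordinates the flux is minus a sum of two squares. This is the discrete trace of the closedness of
`Im (h² dz)`. -/
theorem SHolAt.flux_nonpos {X : Dir → ℂ} (h : SHolAt X) : ∑ d, (X d ^ 2 * dirVec d).im ≤ 0 := by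
  obtain ⟨h1, h2, h3, h4⟩ := h.re_eq
  have hs := Real.sq_sqrt (zero_le_two (α := ℝ))
  have e : ∑ d, (X d ^ 2 * dirVec d).im = 2 * (X 0).re * (X 0).im + ((X 1).re ^ 2 - (X 1).im ^ 2) -
      2 * (X 2).re * (X 2).im - ((X 3).re ^ 2 - (X 3).im ^ 2) := by
    have h3 : Complex.I ^ 3 = -Complex.I := by rw [pow_succ, Complex.I_sq]; ring
    rw [Fin.sum_univ_four]
    simp [dirVec, pow_two, h3]
    ring
  rw [e]
  generalize (X 0).re = x0 at *
  generalize (X 1).re = x1 at *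
  generalize (X 2).re = x2 at *
  generalize (X 3).re = x3 at *
  generalize (X 0).im = y0 at *
  generalize (X 1).im = y1 at *
  generalize (X 2).im = y2 at *
  generalize (X 3).im = y3 at *
  have hpos : 0 ≤ √2 := Real.sqrt_nonneg 2
  generalize √2 = s at *
  -- `A`, `B`, `C`, `D` are the projections at the corners NE, NW, SW, SE.
  obtain ⟨A, hA⟩ : ∃ A, A = x1 + (s - 1) * y1 := ⟨_, rfl⟩
  obtain ⟨B, hB⟩ : ∃ B, B = x1 - (s - 1) * y1 := ⟨_, rfl⟩
  obtain ⟨D, hD⟩ : ∃ D, D = (s - 1) * x3 + y3 := ⟨_, rfl⟩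
  obtain ⟨C, hC⟩ : ∃ C, C = (s - 1) * x3 - y3 := ⟨_, rfl⟩
  have a1 : x1 = (A + B) / 2 := by rw [hA, hB]; ring
  have b1 : y1 = (A - B) * (s + 1) / 2 := by rw [hA, hB]; linear_combination (-y1) * hs
  have a3 : x3 = (D + C) * (s + 1) / 2 := by rw [hC, hD]; linear_combination (-x3) * hs
  have b3 : y3 = (D - C) / 2 := by rw [hC, hD]; ring
  rw [← hA] at h1
  rw [← hB] at h2
  rw [← hD] at h3
  rw [← hC] at h4
  have a0 : x0 = (A - (s - 1) * D) * (s + 1) / 2 := by rw [h1, h3]; grind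
  have b0 : y0 = (D - (s - 1) * A) * (s + 1) / 2 := by rw [h1, h3]; grind
  have a2 : x2 = (B - (s - 1) * C) * (s + 1) / 2 := by rw [h2, h4]; grind
  have b2 : y2 = ((s - 1) * B - C) * (s + 1) / 2 := by rw [h2, h4]; grind
  have key : 2 * x0 * y0 + (x1 ^ 2 - y1 ^ 2) - 2 * x2 * y2 - (x3 ^ 2 - y3 ^ 2) =
      -((s + 1) * ((A - (B + D) * s / 2) ^ 2 + (C - (B - D) * s / 2) ^ 2)) := by
    rw [a0, b0, a1, b1, a2, b2, a3, b3]
    clear hA hB hC hD h1 h2 h3 h4 a0 b0 a1 b1 a2 b2 a3 b3 e hpos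
    grind
  rw [key]
  have : 0 ≤ (s + 1) * ((A - (B + D) * s / 2) ^ 2 + (C - (B - D) * s / 2) ^ 2) := by positivity
  linarith

theorem eq_zero_of_two_projections {μ ν w : ℂ} (h1 : w + μ * (starRingEnd ℂ) w = 0)
    (h2 : w + ν * (starRingEnd ℂ) w = 0) (hne : μ ≠ ν) : w = 0 := by
  have : (μ - ν) * (starRingEnd ℂ) w = 0 := by linear_combination h1 - h2
  rcases mul_eq_zero.1 this with h | h
  · exact absurd (sub_eq_zero.1 h) hne
  · simpa using h

theorem lam_ne_inv : lam ≠ lam⁻¹ := by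
  intro h
  have h1 : lam ^ 2 = 1 := by rw [sq]; nth_rw 2 [h]; exact lam_mul_inv
  rw [lam_sq] at h1
  simpa using congrArg Complex.re h1

theorem lam_cube_ne_inv : lam ^ 3 ≠ (lam ^ 3)⁻¹ := by
  intro h
  have h1 : (lam ^ 3) ^ 2 = 1 := by
    rw [sq]
    nth_rw 2 [h]
    exact mul_inv_cancel₀ (pow_ne_zero _ lam_ne_zero)
  have h2 : (lam ^ 3) ^ 2 = -Complex.I := by
    rw [← pow_mul, mul_comm, pow_mul, lam_sq, pow_succ, Complex.I_sq]
    ring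
  rw [h2] at h1
  simpa using congrArg Complex.re h1

/-- An s-holomorphic function vanishing on the boundary vanishes. -/
theorem SHolomorphic.eq_zero_of_boundary {Ω : SquareGridDomain} {h : Edge → ℂ}
    (hh : SHolomorphic Ω h) (hb : ∀ e ∈ Ω.boundary, h e = 0) {p : Face} (hp : p ∈ Ω.faces)
    (d : Dir) : h (edgeOf p d) = 0 := by
  obtain ⟨M, hM⟩ := (Ω.faces.image Prod.snd).exists_le
  -- Rows are treated from the top down: the north side is known from the row above, the east side
  -- from its projections in the two faces beside it, and the south side from east and west.
  have key : ∀ n : ℕ, ∀ p ∈ Ω.faces, M - p.2 < n → ∀ d, h (edgeOf p d) = 0 := by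
    intro n
    induction n with
    | zero =>
      intro p hp hlt
      have := hM _ (Finset.mem_image_of_mem _ hp)
      push_cast at hlt
      omega
    | succ n ih =>
      have north : ∀ p ∈ Ω.faces, M - p.2 < (n + 1 : ℕ) → h (edgeOf p 1) = 0 := by
        intro p hp hlt
        by_cases hn : nbr p 1 ∈ Ω.faces
        · rw [← edgeOf_nbr]
          refine ih _ hn ?_ _
          simp only [nbr]
          push_cast at hlt
          omega
        · exact hb _ ((Ω.edgeOf_mem_boundary hp).2 hn)
      have east : ∀ p ∈ Ω.faces, M - p.2 < (n + 1 : ℕ) → h (edgeOf p 0) = 0 := by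
        intro p hp hlt
        by_cases hn : nbr p 0 ∈ Ω.faces
        · have h1 := (hh p hp).1
          have h2 := (hh _ hn).2.1
          rw [north p hp hlt, map_zero, mul_zero, add_zero] at h1
          rw [north _ hn (by simpa [nbr] using hlt), map_zero, mul_zero, add_zero] at h2
          have h3 : edgeOf (nbr p 0) 2 = edgeOf p 0 := edgeOf_nbr p 0
          rw [h3] at h2
          exact eq_zero_of_two_projections h1.symm h2.symm lam_ne_inv
        · exact hb _ ((Ω.edgeOf_mem_boundary hp).2 hn)
      have west : ∀ p ∈ Ω.faces, M - p.2 < (n + 1 : ℕ) → h (edgeOf p 2) = 0 := by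
        intro p hp hlt
        by_cases hn : nbr p 2 ∈ Ω.faces
        · have h3 : edgeOf (nbr p 2) 0 = edgeOf p 2 := edgeOf_nbr p 2
          rw [← h3]
          exact east _ hn (by simpa [nbr] using hlt)
        · exact hb _ ((Ω.edgeOf_mem_boundary hp).2 hn)
      intro p hp hlt d
      have h3 := (hh p hp).2.2.1
      have h4 := (hh p hp).2.2.2
      rw [east p hp hlt, map_zero, mul_zero, add_zero] at h3
      rw [west p hp hlt, map_zero, mul_zero, add_zero] at h4
      have south := eq_zero_of_two_projections h3 h4 lam_cube_ne_inv
      fin_cases d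
      exacts [east p hp hlt, north p hp hlt, west p hp hlt, south]
  exact key ((M - p.2).toNat + 1) p hp (by push_cast; omega) d

/-- The outward normal is `i τ_cw`, so `w ^ 2` times it is `i` times a nonnegative real. -/
theorem im_sq_mul_dirVec {Ω : SquareGridDomain} {p : Face} {d : Dir} (hp : p ∈ Ω.faces)
    (hn : nbr p d ∉ Ω.faces) {w : ℂ} (hw : w ∈ lineOf (Ω.tauCw (edgeOf p d))) :
    0 ≤ (w ^ 2 * dirVec d).im ∧ ((w ^ 2 * dirVec d).im = 0 → w = 0) := by
  obtain ⟨r, hr, h⟩ := (mem_lineOf_iff (Ω.tauCw_ne_zero _)).1 hw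
  rw [SquareGridDomain.tauCw, Ω.innerSide_edgeOf hp hn] at h
  have h1 : w ^ 2 * dirVec d = Complex.I * r := by
    rw [← h]
    linear_combination (w ^ 2 * dirVec d) * Complex.I_sq
  rw [h1]
  simp only [Complex.mul_im, Complex.I_re, Complex.I_im, Complex.ofReal_re, Complex.ofReal_im,
    zero_mul, zero_add, one_mul]
  refine ⟨hr, fun h0 => ?_⟩
  rw [h0, Complex.ofReal_zero, mul_zero] at h1
  exact pow_eq_zero_iff two_ne_zero |>.1 ((mul_eq_zero.1 h1).resolve_right (dirVec_ne_zero d))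

/-- An s-holomorphic function with `h ∥ τ_cw ^ (-1/2)` on the whole boundary vanishes. -/
theorem SHolomorphic.eq_zero {Ω : SquareGridDomain} {h : Edge → ℂ}
    (hh : SHolomorphic Ω h) (hb : ∀ e ∈ Ω.boundary, h e ∈ lineOf (Ω.tauCw e)) {e : Edge}
    (he : e ∈ Ω.edges) : h e = 0 := by
  let g : Side → ℝ := fun s => (h (edgeOf s.1 s.2) ^ 2 * dirVec s.2).im
  -- The total flux is counted by edges and by faces: the first count is nonnegative, the second
  -- nonpositive.
  have hsum : ∑ e ∈ Ω.edges, ∑ s ∈ Ω.sidesAt e, g s = ∑ p ∈ Ω.faces, ∑ d, g (p, d) := by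
    rw [← Finset.sum_product']
    exact Finset.sum_fiberwise_of_maps_to
      (fun s hs => Finset.mem_image_of_mem (fun s : Side => edgeOf s.1 s.2) hs) g
  have hle : ∑ p ∈ Ω.faces, ∑ d, g (p, d) ≤ 0 :=
    Finset.sum_nonpos fun p hp => SHolAt.flux_nonpos (X := fun d => h (edgeOf p d)) (hh p hp)
  have hedge : ∀ e ∈ Ω.edges, 0 ≤ ∑ s ∈ Ω.sidesAt e, g s := by
    intro e he
    obtain ⟨p, hp, d, rfl⟩ := Ω.mem_edges.1 he
    by_cases hn : nbr p d ∈ Ω.faces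
    · rw [Ω.sidesAt_edgeOf_of_mem hp hn,
        Finset.sum_pair fun h => nbr_ne p d (Prod.mk.inj h).1.symm]
      simp only [g, edgeOf_nbr, dirVec_add_two, mul_neg, Complex.neg_im, add_neg_cancel, le_refl]
    · rw [Ω.sidesAt_edgeOf_of_notMem hp hn, Finset.sum_singleton]
      exact (im_sq_mul_dirVec hp hn (hb _ ((Ω.edgeOf_mem_boundary hp).2 hn))).1
  have hzero := (Finset.sum_eq_zero_iff_of_nonneg hedge).1
    (le_antisymm (hsum.trans_le hle) (Finset.sum_nonneg hedge))
  have hbd : ∀ e ∈ Ω.boundary, h e = 0 := by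
    intro e he
    have he' := (Finset.mem_filter.1 he).1
    obtain ⟨p, hp, d, rfl⟩ := Ω.mem_edges.1 he'
    have hn := (Ω.edgeOf_mem_boundary hp).1 he
    have h0 := hzero _ he'
    rw [Ω.sidesAt_edgeOf_of_notMem hp hn, Finset.sum_singleton] at h0
    exact (im_sq_mul_dirVec hp hn (hb _ he)).2 h0
  obtain ⟨p, hp, d, rfl⟩ := Ω.mem_edges.1 he
  exact hh.eq_zero_of_boundary hbd hp d

/-! ### The extension given by the observable -/

theorem lam_tipPhase_sq (ρ : ℤ → ℤ → ZMod 2) (G : Finset Edge) (t : Side) :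
    (lam * tipPhase ρ G t) ^ 2 * dirVec t.2 = Complex.I := by
  have h := lam_eta_sq t.2
  have h2 := sgn_mul_self (height ρ G (leftVertex t))
  rw [tipPhase]
  linear_combination h + (lam * eta t.2) ^ 2 * dirVec t.2 * h2

section

variable {Ω : SquareGridDomain}

/-- A boundary value along `τ_ccw ^ (-1/2)` times the observable is a real multiple of the
sum over configurations. -/
theorem exists_real_mul_faceSum {a : Edge} (ha : a ∈ Ω.boundary) {u : ℂ}
    (hu : u ∈ lineOf (Ω.tauCcw a)) :
    ∃ (ρ : ℤ → ℤ → ZMod 2) (x : ℝ),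
      (∀ p ∈ Ω.faces, IsReference ρ (nbr (Ω.innerSide a).1 (Ω.innerSide a).2) p) ∧
      ∀ p ∈ Ω.faces, ∀ d, u * observable betaC Ω a (edgeOf p d) =
        (x : ℂ) * (lam * faceSum Ω ρ (Ω.innerSide a) p d) := by
  have ho := Ω.nbr_innerSide_notMem ha
  have hs := Ω.innerSide_fst_mem ha
  have hobs := fun {ρ} => observable_eq_faceSum (ρ := ρ) hs ho
  rw [Ω.edgeOf_innerSide ha] at hobs
  obtain ⟨ρ, hρ⟩ := Ω.exists_reference ho
  have hc := tipPhase_ne_zero ρ ∅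
    (nbr (Ω.innerSide a).1 (Ω.innerSide a).2, (Ω.innerSide a).2 + 2)
  have hsq := lam_tipPhase_sq ρ ∅
    (nbr (Ω.innerSide a).1 (Ω.innerSide a).2, (Ω.innerSide a).2 + 2)
  have hobs' := fun {p} hp d => hobs hρ (p := p) hp d
  set c := tipPhase ρ ∅ (nbr (Ω.innerSide a).1 (Ω.innerSide a).2, (Ω.innerSide a).2 + 2)
  have hZ : (partitionFunction betaC Ω : ℂ) ≠ 0 :=
    Complex.ofReal_ne_zero.2 (partitionFunction_pos _ _).ne'
  -- The half-edge in `c` points inwards, opposite to the normal, so `lam * c` spans the line of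
  -- `τ_ccw` rather than of `τ_cw`.
  obtain ⟨x, rfl⟩ := exists_real_mul_of_mem_lineOf (Ω.tauCcw_ne_zero a) hu
    (v := lam * c) (by
      simp only [dirVec_add_two] at hsq
      rw [SquareGridDomain.tauCcw, SquareGridDomain.tauCw]
      linear_combination (-Complex.I) * hsq - Complex.I_sq)
  refine ⟨ρ, x * (partitionFunction betaC Ω)⁻¹, hρ, fun p hp d => ?_⟩
  rw [← hobs' hp d]
  push_cast
  field_simp

/-- The edge lies in no configuration, so every tip points outwards and the phases differ only by
signs; the factor `lam` turns them onto the required line. -/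
theorem faceSum_mem_lineOf {s : Side} {ρ : ℤ → ℤ → ZMod 2} {p : Face} {d : Dir}
    (hp : p ∈ Ω.faces) (hn : nbr p d ∉ Ω.faces) (hne : edgeOf p d ≠ edgeOf s.1 s.2) :
    lam * faceSum Ω ρ s p d ∈ lineOf (Ω.tauCw (edgeOf p d)) := by
  rw [faceSum, Finset.mul_sum]
  refine Submodule.sum_mem _ fun G hG => ?_
  have hz : edgeOf p d ∉ G := fun h => by
    rcases Finset.mem_insert.1 ((mem_configs.1 hG).1 h) with h | h
    · exact hne h
    · exact hn (Ω.edgeOf_mem_interior.1 h).2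
  rw [mem_lineOf_iff (Ω.tauCw_ne_zero _), edgePhase, if_neg hz, sideWeight, if_neg hz,
    SquareGridDomain.tauCw, Ω.innerSide_edgeOf hp hn]
  refine ⟨(alphaC ^ G.card) ^ 2, sq_nonneg _, ?_⟩
  have h := lam_tipPhase_sq ρ G (p, d)
  push_cast
  linear_combination (-Complex.I * ((alphaC : ℂ) ^ G.card) ^ 2) * h -
    ((alphaC : ℂ) ^ G.card) ^ 2 * Complex.I_sq

theorem mul_observable_mem_lineOf {a x : Edge} (ha : a ∈ Ω.boundary) (hx : x ∈ Ω.boundary)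
    (hne : x ≠ a) {u : ℂ} (hu : u ∈ lineOf (Ω.tauCcw a)) :
    u * observable betaC Ω a x ∈ lineOf (Ω.tauCw x) := by
  obtain ⟨ρ, r, _, h⟩ := exists_real_mul_faceSum ha hu
  obtain ⟨p, hp, d, rfl⟩ := Ω.mem_edges.1 (Finset.mem_filter.1 hx).1
  rw [h p hp d, ← Complex.real_smul]
  refine Submodule.smul_mem _ _ (faceSum_mem_lineOf hp ((Ω.edgeOf_mem_boundary hp).1 hx) ?_)
  rwa [Ω.edgeOf_innerSide ha]

theorem sHolAt_mul_observable {a : Edge} (ha : a ∈ Ω.boundary) {u : ℂ}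
    (hu : u ∈ lineOf (Ω.tauCcw a)) {p : Face} (hp : p ∈ Ω.faces) :
    SHolAt fun d => u * observable betaC Ω a (edgeOf p d) := by
  obtain ⟨ρ, r, hρ, h⟩ := exists_real_mul_faceSum ha hu
  simp only [h p hp]
  exact (sHolAt_faceSum (Ω.nbr_innerSide_notMem ha) hρ hp).smul r

/-! ### Uniqueness of the extension and identification of the operator -/

theorem SHolomorphic.sub {F G : Edge → ℂ} (hF : SHolomorphic Ω F) (hG : SHolomorphic Ω G) :
    SHolomorphic Ω (F - G) := by
  intro p hp
  have h1 : SHolAt fun d => F (edgeOf p d) := hF p hp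
  have h2 : SHolAt fun d => G (edgeOf p d) := hG p hp
  have h3 := h1.add (h2.smul (-1))
  have h4 : SHolAt fun d => (F - G) (edgeOf p d) := by
    convert h3 using 2 with d
    simp [sub_eq_add_neg]
  exact h4

/-- On `b` the common part `u` cancels, so the difference is parallel to `τ_cw ^ (-1/2)` along the
entire boundary and vanishes. -/
theorem IsExtension.eq_on_edges {b : Finset Edge} {u : b → ℂ}
    {v v' : dataI Ω b} {h h' : Edge → ℂ} (hv : IsExtension Ω b u v h)
    (hv' : IsExtension Ω b u v' h') {x : Edge} (hx : x ∈ Ω.edges) : h x = h' x := by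
  refine sub_eq_zero.1 ((hv.1.sub hv'.1).eq_zero (fun e he => ?_) hx)
  by_cases heb : e ∈ b
  · have h1 := hv.2.1 ⟨e, heb⟩
    have h2 := hv'.2.1 ⟨e, heb⟩
    have h3 : (v : b → ℂ) ⟨e, heb⟩ ∈ lineOf (Ω.tauCw e) :=
      (Submodule.mem_pi.1 v.2) ⟨e, heb⟩ (Set.mem_univ _)
    have h4 : (v' : b → ℂ) ⟨e, heb⟩ ∈ lineOf (Ω.tauCw e) :=
      (Submodule.mem_pi.1 v'.2) ⟨e, heb⟩ (Set.mem_univ _)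
    simp only at h1 h2
    rw [Pi.sub_apply, h1, h2, add_sub_add_left_eq_sub]
    exact Submodule.sub_mem _ h3 h4
  · exact Submodule.sub_mem _ (hv.2.2 e he heb) (hv'.2.2 e he heb)

theorem IsExtension.unique {b : Finset Edge} (hb : b ⊆ Ω.boundary) {u : b → ℂ}
    {v v' : dataI Ω b} {h h' : Edge → ℂ} (hv : IsExtension Ω b u v h)
    (hv' : IsExtension Ω b u v' h') : v = v' := by
  refine Subtype.ext (funext fun e => ?_)
  have h1 := hv.2.1 e
  have h2 := hv'.2.1 e
  rw [hv.eq_on_edges hv' (Finset.mem_filter.1 (hb e.2)).1, h2] at h1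
  exact (add_left_cancel h1).symm

/-- Each term solves the problem with `u` supported at one edge: at its own start the observable is
`1` and reproduces `u`, while at the other boundary edges it contributes only along `τ_cw ^ (-1/2)`.
-/
theorem exists_isExtension {b : Finset Edge} (hb : b ⊆ Ω.boundary) (u : dataR Ω b) :
    ∃ v : dataI Ω b,
      (∀ x : b, (v : b → ℂ) x = ∑ y ∈ Finset.univ.filter (fun y : b => (y : Edge) ≠ x),
        (u : b → ℂ) y * observable betaC Ω y x) ∧
      IsExtension Ω b (u : b → ℂ) (v : b → ℂ)
        (fun x => ∑ y : b, (u : b → ℂ) y * observable betaC Ω y x) := by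
  have hu : ∀ y : b, (u : b → ℂ) y ∈ lineOf (Ω.tauCcw y) := fun y =>
    (Submodule.mem_pi.1 u.2) y (Set.mem_univ _)
  refine ⟨⟨fun x => ∑ y ∈ Finset.univ.filter (fun y : b => (y : Edge) ≠ x),
    (u : b → ℂ) y * observable betaC Ω y x, ?_⟩, fun x => rfl, ?_, ?_, ?_⟩
  · refine Submodule.mem_pi.2 fun x _ => Submodule.sum_mem _ fun y hy => ?_
    exact mul_observable_mem_lineOf (hb y.2) (hb x.2) (Finset.mem_filter.1 hy).2.symm (hu y)
  · intro p hp
    have h := SHolAt.sum Finset.univ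
      (fun (y : b) d => (u : b → ℂ) y * observable betaC Ω y (edgeOf p d))
      fun y _ => sHolAt_mul_observable (hb y.2) (hu y) hp
    have h' : SHolAt fun d => ∑ y : b, (u : b → ℂ) y * observable betaC Ω y (edgeOf p d) := by
      convert h using 1
      ext d
      rw [Finset.sum_apply]
    exact h'
  · intro x
    have h := Finset.sum_filter_add_sum_filter_not Finset.univ (fun y : b => (y : Edge) ≠ x)
      (fun y => (u : b → ℂ) y * observable betaC Ω y x)
    have h1 : Finset.univ.filter (fun y : b => ¬(y : Edge) ≠ x) = {x} := by
      ext y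
      rw [Finset.mem_filter, Finset.mem_singleton, not_not, Subtype.ext_iff]
      simp only [Finset.mem_univ, true_and]
    rw [h1, Finset.sum_singleton, observable, if_pos rfl, mul_one, add_comm] at h
    exact h.symm
  · intro e he heb
    exact Submodule.sum_mem _ fun y _ => mul_observable_mem_lineOf (hb y.2) he
      (fun h => heb (h ▸ y.2)) (hu y)

theorem rpsOperator_eq {b : Finset Edge} (hb : b ⊆ Ω.boundary) {u : dataR Ω b}
    {v : dataI Ω b} {h : Edge → ℂ} (hv : IsExtension Ω b (u : b → ℂ) (v : b → ℂ) h) :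
    rpsOperator Ω b u = v := by
  have hex : ∃ v : dataI Ω b, ∃ h : Edge → ℂ, IsExtension Ω b u v h := ⟨v, h, hv⟩
  rw [rpsOperator, dif_pos hex]
  obtain ⟨h', hh'⟩ := hex.choose_spec
  exact hh'.unique hb hv

end
end IsingRPS
end

theorem mainTheorem10 (Ω : IsingRPS.SquareGridDomain) (b : Finset IsingRPS.Edge)
    (hb : b ⊆ Ω.boundary) (u : IsingRPS.dataR Ω b) :
    (∃! v : IsingRPS.dataI Ω b,
      ∃ h : IsingRPS.Edge → ℂ, IsingRPS.IsExtension Ω b (u : b → ℂ) (v : b → ℂ) h) ∧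
    (∃ h : IsingRPS.Edge → ℂ, IsingRPS.IsExtension Ω b (u : b → ℂ)
      (IsingRPS.rpsOperator Ω b u : b → ℂ) h) ∧
    (∀ x : b, (IsingRPS.rpsOperator Ω b u : b → ℂ) x =
      ∑ y ∈ Finset.univ.filter (fun y : b => (y : IsingRPS.Edge) ≠ x),
        (u : b → ℂ) y * IsingRPS.observable IsingRPS.betaC Ω y x) ∧
    (∀ h : IsingRPS.Edge → ℂ,
      IsingRPS.IsExtension Ω b (u : b → ℂ) (IsingRPS.rpsOperator Ω b u : b → ℂ) h →
        (∀ x ∈ Ω.edges, h x = ∑ y : b, (u : b → ℂ) y * IsingRPS.observable IsingRPS.betaC Ω y x) ∧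
        (∀ x ∈ Ω.boundary, x ∉ b →
          h x = ∑ y ∈ Finset.univ.filter (fun y : b => (y : IsingRPS.Edge) ≠ x),
            (u : b → ℂ) y * IsingRPS.observable IsingRPS.betaC Ω y x)) := by
  obtain ⟨v, hval, hext⟩ := IsingRPS.exists_isExtension hb u
  rw [IsingRPS.rpsOperator_eq hb hext]
  refine ⟨⟨v, ⟨_, hext⟩, ?_⟩, ⟨_, hext⟩, ?_, ?_⟩
  · rintro v' ⟨h', hh'⟩
    exact hh'.unique hb hext
  · intro x
    rw [hval x]
  · intro h hh
    have hedges : ∀ x ∈ Ω.edges,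
        h x = ∑ y : b, (u : b → ℂ) y * IsingRPS.observable IsingRPS.betaC Ω y x :=
      fun x hx => hh.eq_on_edges hext hx
    refine ⟨hedges, fun x hx hxb => ?_⟩
    -- Outside `b` the restriction `y ≠ x` is vacuous.
    rw [hedges x (Finset.mem_filter.1 hx).1, Finset.filter_true_of_mem]
    exact fun y _ hy => hxb (hy ▸ y.2)
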